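/- **Hard sphere dynamics is defined almost everywhere, globally in time.** Let $d\ge 2$ and $N\ge 2$ be integers and let $0<\varepsilon\le 1$. Consider $N$ spherical particles of unit mass and radius $\varepsilon/2$ in the half-space $\{x\in\mathbb R^d : x\cdot e_1>0\}$, where $e_1$ is the first vector of the canonical basis. The phase space is $$\mathcal D^\varepsilon_N=\Big\{(x_1,\dots,x_N,v_1,\dots,v_N)\in\mathbb R^{2dN} : x_i\cdot e_1\ge \varepsilon/2\ \text{ for all } i,\ \ |x_j-x_k|\ge\varepsilon\ \text{ for all } j<k\Big\}.$$ The dynamics is as follows. Each particle moves in a straight line at constant velocity except at its *events*, which are of two kinds: * particle $i$ *bounces* if it arrives with $x_i\cdot e_1=\varepsilon/2$ and $v_i\cdot e_1<0$; then $v_i$ is replaced by $v_i-2(v_i\cdot e_1)e_1$; * particles $i\ne j$ *collide* if they arrive with $x_j=x_i+\varepsilon\omega$, $|\omega|=1$, and $\omega\cdot(v_j-v_i)<0$; then $v_i,v_j$ are replaced by $v_i-((v_i-v_j)\cdot\omega)\,\omega$ and $v_j+((v_i-v_j)\cdot\omega)\,\omega$. Particle $i$ is involved in *simultaneous events* at a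 given time if, at that time, it is involved in an event and moreover has a second contact: it bounces while touching another particle, or it collides with a particle while touching the wall or a third particle (this includes every case of two events of the same particle at the same time). The dynamics started at $Z_N$ is *well-defined on $[0,T)$* if it can be followed, inside $\mathcal D^\varepsilon_N$, on every $[0,T']$ with $T'<T$, with only finitely many event times in $[0,T']$ and no simultaneous events at any time of $[0,T']$. The trajectory of $Z_N$ is *pathological* if for some $T\ge 0$ the dynamics is well-defined on $[0,T)$ with only finitely many event times there, and simultaneous events occur at time $T$. Let $\mathcal E(Z_N)\subset\mathbb R_+$ be the set of the times of all the events in the largest interval $[0,T^*)$ on which the dynamics started at $Z_N$ is well-defined. Then: 1. the set of the $Z_N\in\mathcal D^\varepsilon_N$ whose trajectory is pathological has Lebesgue measure zero in $\mathbb R^{2dN}$; 2. for all $Z_N\in\mathcal D^\varepsilon_N$ outside a set of Lebesgue measure zero, the set $\mathcal E(Z_N)$ is discrete in $\mathbb R_+$, that is, it has no accumulation point in $\mathbb{R}$; 3. for all $Z_N\in\mathcal D^\varepsilon_N$ outside a set of Lebesgue measure zero, the dynamics started at $Z_N$ exists and is unique on the whole of $\mathbb R_+$. -/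

import Mathlib

open MeasureTheory Set
open scoped Topology Filter

namespace HardSphere

/-- The Euclidean space `ℝ^d`. -/
abbrev Vec (d : ℕ) := EuclideanSpace ℝ (Fin d)

/-- A configuration: the positions `(x_1, …, x_N)` and the velocities `(v_1, …, v_N)`.
The measure `volume` on this type is the Lebesgue measure of `ℝ^{2dN}`. -/
abbrev Config (d N : ℕ) := (Fin N → Vec d) × (Fin N → Vec d)

/-- The first vector of the canonical basis, normal to the wall. -/
noncomputable def e₁ (d : ℕ) [NeZero d] : Vec d := EuclideanSpace.single 0 1

/-- The phase space of `N` hard spheres of radius `ε / 2` in the half-space `x · e₁ > 0`. -/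
def phaseSpace (d N : ℕ) [NeZero d] (ε : ℝ) : Set (Config d N) :=
  {Z | (∀ i, ε / 2 ≤ inner ℝ (Z.1 i) (e₁ d)) ∧ ∀ j k, j < k → ε ≤ ‖Z.1 j - Z.1 k‖}

section Events

variable {d N : ℕ} [NeZero d] (ε : ℝ) (x v : Fin N → Vec d)

/-- Particle `i` touches the wall. -/
def TouchesWall (i : Fin N) : Prop := inner ℝ (x i) (e₁ d) = ε / 2

/-- Particle `i` touches the other particle `j`. -/
def Touches (i j : Fin N) : Prop := i ≠ j ∧ ‖x i - x j‖ = ε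

/-- Particle `i`, arriving with velocity `v i`, bounces against the wall. -/
def Bounces (i : Fin N) : Prop := TouchesWall ε x i ∧ inner ℝ (v i) (e₁ d) < 0

/-- Particles `i` and `j` touch and arrive with pre-collisional velocities: they collide. -/
def Collides (i j : Fin N) : Prop := Touches ε x i j ∧ inner ℝ (x j - x i) (v j - v i) < 0

/-- Particle `i` is involved in an event (a bounce or a collision). -/
def HasEvent (i : Fin N) : Prop := Bounces ε x v i ∨ ∃ j, Collides ε x v i j

/-- Particle `i` is involved in an event and has, at the same time, a second contact: it bounces
against the wall while touching a particle, or it collides with a particle while touching the wall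
or a third particle. The second contact need not be pre-collisional for the arriving
velocities: the velocity given to `i` by the first event may turn it into a pre-collisional one. -/
def SimultaneousEvents (i : Fin N) : Prop :=
  (Bounces ε x v i ∧ ∃ j, Touches ε x i j) ∨
  (TouchesWall ε x i ∧ ∃ j, Collides ε x v i j) ∨
  (∃ j k, j ≠ k ∧ Collides ε x v i j ∧ Touches ε x i k)

/-- The velocities `v'` are obtained from the arriving velocities `v` by specular reflection for
the particles that bounce, by the scattering mapping with `ω = (x j - x i) / ε` for the
particles that collide, and they are unchanged for the other particles. -/
def IsOutgoing (v' : Fin N → Vec d) : Prop :=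
  ∀ i,
    (Bounces ε x v i → v' i = v i - (2 * inner ℝ (v i) (e₁ d)) • e₁ d) ∧
    (∀ j, Collides ε x v i j →
      v' i = v i - inner ℝ (v i - v j) (ε⁻¹ • (x j - x i)) • (ε⁻¹ • (x j - x i))) ∧
    (¬ HasEvent ε x v i → v' i = v i)

end Events

section Motion

variable {d N : ℕ} [NeZero d] (ε : ℝ) (Z : Config d N)

/-- The hard sphere dynamics started at `Z` is well-defined on `[0, T)` and arrives at time `T` with
positions `x T` and velocities `vin T`. Here `x t` are the positions at time `t`, and `vin t`,
`vout t` are the velocities just before and just after time `t` (at time `0`, `vin 0` are the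
initial velocities). Nothing is asked of the passage from `vin T` to `vout T`, so that
the events at time `T` may be simultaneous. -/
structure IsMotion (T : ℝ) (x vin vout : ℝ → Fin N → Vec d) : Prop where
  nonneg : 0 ≤ T
  init_pos : x 0 = Z.1
  init_vel : vin 0 = Z.2
  mem_phaseSpace : ∀ t ∈ Icc 0 T, (x t, vin t) ∈ phaseSpace d N ε
  /-- events do not accumulate before `T`, nor at `T` -/
  finite_events : {t | t ∈ Ico 0 T ∧ ∃ i, HasEvent ε (x t) (vin t) i}.Finite
  not_simultaneous : ∀ t ∈ Ico 0 T, ∀ i, ¬ SimultaneousEvents ε (x t) (vin t) i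
  outgoing : ∀ t ∈ Ico 0 T, IsOutgoing ε (x t) (vin t) (vout t)
  /-- each particle moves freely between two of its events -/
  free_flight : ∀ i s t, 0 ≤ s → s < t → t ≤ T →
    (∀ u ∈ Ioo s t, ¬ HasEvent ε (x u) (vin u) i) →
      x t i = x s i + (t - s) • vout s i ∧ vin t i = vout s i

/-- The trajectory started at `Z` is pathological: at some time `T ≥ 0`, reached by a dynamics that
is well-defined before `T`, a particle is involved in simultaneous events. -/
def Pathological : Prop :=
  ∃ T x vin vout, IsMotion ε Z T x vin vout ∧ ∃ i, SimultaneousEvents ε (x T) (vin T) i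

/-- The times of the events of the dynamics started at `Z`, in the largest interval of the form
`[0, T*)` on which it is well-defined (`T*` is the supremum of the times `T` below; it is
infinite, the time of simultaneous events, or a time where events accumulate). -/
def eventTimes : Set ℝ :=
  {t | 0 ≤ t ∧ ∃ T x vin vout, t < T ∧ IsMotion ε Z T x vin vout ∧
    ∃ i, HasEvent ε (x t) (vin t) i}

/-- The dynamics started at `Z` is defined for all times `t ≥ 0`, in a unique way. -/
def GloballyDefined : Prop :=
  ∃ x vin vout, (∀ T, 0 ≤ T → IsMotion ε Z T x vin vout) ∧
    ∀ T x' vin' vout', IsMotion ε Z T x' vin' vout' →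
      EqOn x' x (Icc 0 T) ∧ EqOn vin' vin (Icc 0 T) ∧ EqOn vout' vout (Ico 0 T)

end Motion

end HardSphere

set_option linter.unusedSectionVars false

namespace HardSphere

/-! Null pathologies: a straight flight is coded by its configuration at time 0. If it meets a
degenerate configuration, the event fixes the time as a function of the flight, while a translation
of positions that keeps this time moves the second contact. By Fubini such flights form a null set
(`volume_degenerateSet`). Away from degeneracy each event time carries a single collision or bounce,
and the flight before it is a differentiable function of the flight after it. Differentiable maps
send null sets to null sets, only finitely many maps occur, and a trajectory crosses finitely many
events before its pathology. Pulled back to time 0, pathologies therefore lie in a countable union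
of null sets (`volume_badSet`, `IsMotion.mem_iUnion_badSet`). Neither invariance of the measure nor
a truncation in time or velocity is needed.

Global existence: a motion without simultaneous events at its final time can be continued
(`IsMotion.exists_extension`), so it remains to rule out accumulation of events at a finite time
`b`, which never occurs (`finite_events_of_forall_lt`). Each impulse raises the virial ∑ vᵢ·xᵢ by an
amount that controls the velocity jump, and conservation of energy bounds the virial on [0, b). The
velocities thus have a limit v'. Contacts near `b` are asymptotically tangential to v', so no
impulse near `b` increases ∑ vᵢ·v'ᵢ. This sum tends to ∑ |v'ᵢ|², which by conservation of energy
equals ∑ |vᵢ|²; hence v = v' near `b`, and no event happens there. Discreteness of the event times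
follows from global existence and uniqueness. -/

/-- Induction on the number of points of `E` strictly between the endpoints. The endpoints
themselves may lie in `E`: an elementary step is the jump at `s` followed by a free flight. -/
theorem rel_of_finite {E : Set ℝ} (hE : E.Finite) {a b : ℝ} {P : ℝ → ℝ → Prop}
    (hstep : ∀ s t, a ≤ s → s < t → t ≤ b → (∀ u ∈ Ioo s t, u ∉ E) → P s t)
    (htrans : ∀ s u t, a ≤ s → s < u → u < t → t ≤ b → P s u → P u t → P s t)
    {s t : ℝ} (hs : a ≤ s) (hst : s < t) (ht : t ≤ b) : P s t := by
  have key : ∀ n : ℕ, ∀ s t, a ≤ s → s < t → t ≤ b → (E ∩ Ioo s t).ncard ≤ n → P s t := by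
    intro n
    induction n with
    | zero =>
      intro s t hs hst ht hn
      refine hstep s t hs hst ht fun u hu huE => ?_
      have h0 : E ∩ Ioo s t = ∅ :=
        (Set.ncard_eq_zero (hE.subset inter_subset_left)).1 (Nat.le_zero.1 hn)
      exact (h0 ▸ ⟨huE, hu⟩ : u ∈ (∅ : Set ℝ))
    | succ n ih =>
      intro s t hs hst ht hn
      by_cases h : ∀ u ∈ Ioo s t, u ∉ E
      · exact hstep s t hs hst ht h
      · push Not at h
        obtain ⟨u, hu, huE⟩ := h
        have hlt : ∀ p q, s ≤ p → q ≤ t → u ∉ Ioo p q → (E ∩ Ioo p q).ncard ≤ n := by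
          intro p q hp hq hupq
          have : (E ∩ Ioo p q).ncard < (E ∩ Ioo s t).ncard := by
            refine Set.ncard_lt_ncard ⟨inter_subset_inter_right _ (Ioo_subset_Ioo hp hq), ?_⟩
              (hE.subset inter_subset_left)
            exact fun hsub => hupq (hsub ⟨huE, hu⟩).2
          omega
        exact htrans s u t hs hu.1 hu.2 ht
          (ih s u hs hu.1 (hu.2.le.trans ht) (hlt s u le_rfl hu.2.le (fun h => lt_irrefl _ h.2)))
          (ih u t (hs.trans hu.1.le) hu.2 ht (hlt u t hu.1.le le_rfl (fun h => lt_irrefl _ h.1)))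
  exact key _ s t hs hst ht le_rfl

/-! ### Impulses at one event time: energy and virial balance -/

section Events

variable {d N : ℕ} [NeZero d] {ε : ℝ} {x v v' : Fin N → Vec d}

theorem norm_e₁ : ‖e₁ d‖ = 1 := by simp [e₁]

theorem inner_e₁_e₁ : inner ℝ (e₁ d) (e₁ d) = 1 := by
  rw [real_inner_self_eq_norm_sq, norm_e₁, one_pow]

theorem Touches.symm {i j : Fin N} (h : Touches ε x i j) : Touches ε x j i :=
  ⟨h.1.symm, by rw [norm_sub_rev]; exact h.2⟩

theorem Collides.inner_neg {i j : Fin N} (h : Collides ε x v i j) :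
    inner ℝ (x i - x j) (v i - v j) < 0 := by
  have := h.2
  rwa [← neg_sub (x i), ← neg_sub (v i), inner_neg_neg] at this

theorem Collides.symm {i j : Fin N} (h : Collides ε x v i j) : Collides ε x v j i :=
  ⟨h.1.symm, h.inner_neg⟩

theorem Collides.out_eq {i j : Fin N} (h : Collides ε x v i j) (hv : IsOutgoing ε x v v') :
    v' i = v i - (inner ℝ (x i - x j) (v i - v j) / ε ^ 2) • (x i - x j) := by
  rw [(hv i).2.1 j h, ← neg_sub (x i) (x j), inner_smul_right, inner_neg_right,
    real_inner_comm (v i - v j), smul_neg, smul_neg, smul_smul]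
  congr 1
  module
  
end Events

section Jumps

variable {d N : ℕ} [NeZero d] {ε : ℝ} {x v v' : Fin N → Vec d}

open Classical in
/-- The impulse along `x i - x j` that particle `i` receives from particle `j`. -/
noncomputable def kick (ε : ℝ) (x v : Fin N → Vec d) (i j : Fin N) : ℝ :=
  if Collides ε x v i j then -(inner ℝ (x i - x j) (v i - v j) / ε ^ 2) else 0

open Classical in
/-- The impulse along `e₁` that particle `i` receives from the wall. -/
noncomputable def wallKick (ε : ℝ) (x v : Fin N → Vec d) (i : Fin N) : ℝ :=
  if Bounces ε x v i then -(2 * inner ℝ (v i) (e₁ d)) else 0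

theorem kick_symm (i j : Fin N) : kick ε x v i j = kick ε x v j i := by
  by_cases h : Collides ε x v i j
  · rw [kick, kick, if_pos h, if_pos h.symm, ← neg_sub (x j), ← neg_sub (v j), inner_neg_neg]
  · rw [kick, kick, if_neg h, if_neg fun h' => h (Collides.symm h')]

theorem kick_nonneg (i j : Fin N) : 0 ≤ kick ε x v i j := by
  unfold kick
  split_ifs with h
  · have := h.inner_neg
    exact neg_nonneg.2 (div_nonpos_of_nonpos_of_nonneg this.le (sq_nonneg _))
  · exact le_rfl

theorem collides_of_kick_ne_zero {i j : Fin N} (h : kick ε x v i j ≠ 0) : Collides ε x v i j := by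
  by_contra hc
  simp [kick, hc] at h

theorem wallKick_nonneg (i : Fin N) : 0 ≤ wallKick ε x v i := by
  unfold wallKick
  split_ifs with h
  · linarith [h.2]
  · exact le_rfl

theorem bounces_of_wallKick_ne_zero {i : Fin N} (h : wallKick ε x v i ≠ 0) :
    Bounces ε x v i := by
  by_contra hc
  simp [wallKick, hc] at h

/-- Without simultaneous events at most one impulse on `i` is nonzero; writing the jump as a full
sum removes case distinctions from the balance laws. -/
theorem outgoing_eq_add (hns : ∀ i, ¬ SimultaneousEvents ε x v i) (hv : IsOutgoing ε x v v')
    (i : Fin N) :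
    v' i - v i = ∑ j, kick ε x v i j • (x i - x j) + wallKick ε x v i • e₁ d := by
  have hi := hns i
  simp only [SimultaneousEvents, not_or, not_and, not_exists] at hi
  obtain ⟨h1, h2, h3⟩ := hi
  by_cases hb : Bounces ε x v i
  · have hk : ∀ j, kick ε x v i j = 0 := fun j => by
      by_contra h
      exact h1 hb j (collides_of_kick_ne_zero h).1
    simp [hk, wallKick, hb, (hv i).1 hb]
  · have hw : wallKick ε x v i = 0 := by simp [wallKick, hb]
    by_cases hc : ∃ j, Collides ε x v i j
    · obtain ⟨j, hj⟩ := hc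
      have hk : ∀ k, k ≠ j → kick ε x v i k = 0 := fun k hkj => by
        by_contra h
        exact h3 j k hkj.symm hj (collides_of_kick_ne_zero h).1
      rw [hw, Finset.sum_eq_single j (fun k _ hk' => by rw [hk k hk', zero_smul]) (by simp),
        hj.out_eq hv, kick, if_pos hj]
      module
    · have hk : ∀ j, kick ε x v i j = 0 := fun j => by
        by_contra h
        exact hc ⟨j, collides_of_kick_ne_zero h⟩
      simp [hk, hw, (hv i).2.2 (by simp [HasEvent, hb, hc])]

/-- Action and reaction: `kick` is symmetric and `x i - x j` antisymmetric, so exchanging `i` and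
`j` symmetrizes the double sum. It serves with three test vectors: `v' + v` for the energy, `x` for
the virial, and the limit velocities in the proof of non-accumulation. -/
theorem sum_inner_jump (hns : ∀ i, ¬ SimultaneousEvents ε x v i) (hv : IsOutgoing ε x v v')
    (φ : Fin N → Vec d) :
    ∑ i, inner ℝ (v' i - v i) (φ i) =
      (∑ i, ∑ j, kick ε x v i j * inner ℝ (x i - x j) (φ i - φ j)) / 2 +
        ∑ i, wallKick ε x v i * inner ℝ (e₁ d) (φ i) := by
  have h1 : ∑ i, inner ℝ (v' i - v i) (φ i) =
      ∑ i, ∑ j, kick ε x v i j * inner ℝ (x i - x j) (φ i) +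
        ∑ i, wallKick ε x v i * inner ℝ (e₁ d) (φ i) := by
    rw [← Finset.sum_add_distrib]
    refine Finset.sum_congr rfl fun i _ => ?_
    rw [outgoing_eq_add hns hv, inner_add_left, sum_inner, real_inner_smul_left]
    simp only [real_inner_smul_left]
  have h2 : ∑ i, ∑ j, kick ε x v i j * inner ℝ (x i - x j) (φ i) =
      -∑ i, ∑ j, kick ε x v i j * inner ℝ (x i - x j) (φ j) := by
    rw [Finset.sum_comm, ← Finset.sum_neg_distrib]
    refine Finset.sum_congr rfl fun i _ => ?_
    rw [← Finset.sum_neg_distrib]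
    refine Finset.sum_congr rfl fun j _ => ?_
    rw [kick_symm, ← neg_sub (x i), inner_neg_left]
    ring
  have h3 : ∑ i, ∑ j, kick ε x v i j * inner ℝ (x i - x j) (φ i - φ j) =
      ∑ i, ∑ j, kick ε x v i j * inner ℝ (x i - x j) (φ i) -
        ∑ i, ∑ j, kick ε x v i j * inner ℝ (x i - x j) (φ j) := by
    simp only [inner_sub_right, mul_sub, Finset.sum_sub_distrib]
  rw [h1, h3]
  linarith

theorem Collides.norm_sq {i j : Fin N} (h : Collides ε x v i j) :
    inner ℝ (x i - x j) (x i - x j) = ε ^ 2 := by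
  rw [real_inner_self_eq_norm_sq, h.1.2]

theorem Collides.inner_out (hε : 0 < ε) {i j : Fin N} (h : Collides ε x v i j)
    (hv : IsOutgoing ε x v v') :
    inner ℝ (x i - x j) (v' i - v' j) = -inner ℝ (x i - x j) (v i - v j) := by
  have e : v' i - v' j = (v i - v j)
      - (2 * (inner ℝ (x i - x j) (v i - v j) / ε ^ 2)) • (x i - x j) := by
    rw [h.out_eq hv, h.symm.out_eq hv, ← neg_sub (x i) (x j), ← neg_sub (v i) (v j),
      inner_neg_neg]
    module
  rw [e, inner_sub_right, inner_smul_right, h.norm_sq]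
  field_simp
  ring

theorem Bounces.inner_out {i : Fin N} (h : Bounces ε x v i) (hv : IsOutgoing ε x v v') :
    inner ℝ (v' i) (e₁ d) = -inner ℝ (v i) (e₁ d) := by
  rw [(hv i).1 h, inner_sub_left, real_inner_smul_left, inner_e₁_e₁]
  ring

theorem sum_norm_sq_outgoing (hε : 0 < ε) (hns : ∀ i, ¬ SimultaneousEvents ε x v i)
    (hv : IsOutgoing ε x v v') : ∑ i, ‖v' i‖ ^ 2 = ∑ i, ‖v i‖ ^ 2 := by
  have h := sum_inner_jump hns hv (fun i => v' i + v i)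
  have h1 : ∀ i, inner ℝ (v' i - v i) (v' i + v i) = ‖v' i‖ ^ 2 - ‖v i‖ ^ 2 := fun i => by
    rw [inner_sub_left, inner_add_right, inner_add_right, real_inner_self_eq_norm_sq,
      real_inner_self_eq_norm_sq, real_inner_comm]
    ring
  have h2 : ∀ i j, kick ε x v i j * inner ℝ (x i - x j) (v' i + v i - (v' j + v j)) = 0 := by
    intro i j
    by_cases hc : Collides ε x v i j
    · rw [add_sub_add_comm, inner_add_right, hc.inner_out hε hv]
      ring
    · simp [kick, hc]
  have h3 : ∀ i, wallKick ε x v i * inner ℝ (e₁ d) (v' i + v i) = 0 := by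
    intro i
    by_cases hb : Bounces ε x v i
    · rw [real_inner_comm, inner_add_left, hb.inner_out hv]
      ring
    · simp [wallKick, hb]
  simp only [h1, h2, h3, Finset.sum_sub_distrib, Finset.sum_const_zero] at h
  linarith

/-- With the positions as test vectors every impulse contributes positively: a kick has weight `ε ^
2` and a wall kick weight `ε / 2`, because the contact plane lies at height `ε / 2 > 0`. The factor
`2 / ε` makes the latter weight 1; the halved double sum then gives the former weight `ε`. -/
theorem norm_jump_le (hε : 0 < ε) (hns : ∀ i, ¬ SimultaneousEvents ε x v i)
    (hv : IsOutgoing ε x v v') (i : Fin N) :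
    ‖v' i - v i‖ ≤ 2 / ε * ∑ k, inner ℝ (v' k - v k) (x k) := by
  have h2 : ∀ i j, kick ε x v i j * inner ℝ (x i - x j) (x i - x j) = kick ε x v i j * ε ^ 2 := by
    intro i j
    by_cases hc : Collides ε x v i j
    · rw [hc.norm_sq]
    · simp [kick, hc]
  have h3 : ∀ i, wallKick ε x v i * inner ℝ (e₁ d) (x i) = wallKick ε x v i * (ε / 2) := by
    intro i
    by_cases hb : Bounces ε x v i
    · rw [real_inner_comm, show inner ℝ (x i) (e₁ d) = ε / 2 from hb.1]
    · simp [wallKick, hb]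
  have hL : ‖v' i - v i‖ ≤ ∑ j, kick ε x v i j * ε + wallKick ε x v i := by
    rw [outgoing_eq_add hns hv]
    refine (norm_add_le _ _).trans (add_le_add ((norm_sum_le _ _).trans ?_) ?_)
    · refine Finset.sum_le_sum fun j _ => ?_
      rw [norm_smul, Real.norm_of_nonneg (kick_nonneg _ _)]
      by_cases hc : Collides ε x v i j
      · rw [hc.1.2]
      · simp [kick, hc]
    · rw [norm_smul, Real.norm_of_nonneg (wallKick_nonneg _), norm_e₁, mul_one]
  rw [sum_inner_jump hns hv]
  simp only [h2, h3]
  simp only [← Finset.sum_mul]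
  have hA : ∑ j, kick ε x v i j ≤ ∑ i, ∑ j, kick ε x v i j :=
    Finset.single_le_sum (f := fun i => ∑ j, kick ε x v i j)
      (fun i _ => Finset.sum_nonneg fun j _ => kick_nonneg i j) (Finset.mem_univ i)
  have hB : wallKick ε x v i ≤ ∑ i, wallKick ε x v i :=
    Finset.single_le_sum (f := fun i => wallKick ε x v i)
      (fun i _ => wallKick_nonneg i) (Finset.mem_univ i)
  rw [← Finset.sum_mul] at hL
  have e : 2 / ε * ((∑ i, ∑ j, kick ε x v i j) * ε ^ 2 / 2 +
      (∑ i, wallKick ε x v i) * (ε / 2)) =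
      (∑ i, ∑ j, kick ε x v i j) * ε + ∑ i, wallKick ε x v i := by
    field_simp
  rw [e]
  exact hL.trans (add_le_add (mul_le_mul_of_nonneg_right hA hε.le) hB)

theorem outgoing_ne (hε : 0 < ε) (hv : IsOutgoing ε x v v') {i : Fin N}
    (h : HasEvent ε x v i) : v' ≠ v := by
  rintro rfl
  rcases h with h | ⟨j, h⟩
  · have := h.inner_out hv
    linarith [h.2]
  · have := h.inner_out hε hv
    linarith [h.inner_neg]

theorem outgoing_unique {v'' : Fin N → Vec d} (hv : IsOutgoing ε x v v')
    (hv' : IsOutgoing ε x v v'') : v' = v'' := by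
  funext i
  by_cases h : HasEvent ε x v i
  · rcases h with h | ⟨j, h⟩
    · rw [(hv i).1 h, (hv' i).1 h]
    · rw [(hv i).2.1 j h, (hv' i).2.1 j h]
  · rw [(hv i).2.2 h, (hv' i).2.2 h]

theorem outgoing_eq_of_not_hasEvent (hv : IsOutgoing ε x v v')
    (h : ∀ i, ¬ HasEvent ε x v i) : v' = v :=
  funext fun i => (hv i).2.2 (h i)

theorem exists_outgoing (hns : ∀ i, ¬ SimultaneousEvents ε x v i) :
    ∃ v', IsOutgoing ε x v v' := by
  have H : ∀ i, ∃ w : Vec d,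
      (Bounces ε x v i → w = v i - (2 * inner ℝ (v i) (e₁ d)) • e₁ d) ∧
      (∀ j, Collides ε x v i j →
        w = v i - inner ℝ (v i - v j) (ε⁻¹ • (x j - x i)) • (ε⁻¹ • (x j - x i))) ∧
      (¬ HasEvent ε x v i → w = v i) := by
    intro i
    have hi := hns i
    simp only [SimultaneousEvents, not_or, not_and, not_exists] at hi
    obtain ⟨h1, h2, h3⟩ := hi
    by_cases hb : Bounces ε x v i
    · exact ⟨_, fun _ => rfl, fun j hj => (h1 hb j hj.1).elim, fun h => (h (Or.inl hb)).elim⟩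
    · by_cases hc : ∃ j, Collides ε x v i j
      · obtain ⟨j, hj⟩ := hc
        refine ⟨v i - inner ℝ (v i - v j) (ε⁻¹ • (x j - x i)) • (ε⁻¹ • (x j - x i)),
          fun h => (hb h).elim, fun k hk => ?_, fun h => (h (Or.inr ⟨j, hj⟩)).elim⟩
        by_cases hjk : j = k
        · rw [hjk]
        · exact (h3 j k hjk hj hk.1).elim
      · exact ⟨v i, fun h => (hb h).elim, fun j hj => (hc ⟨j, hj⟩).elim, fun _ => rfl⟩
  choose w hw using H
  exact ⟨w, hw⟩

end Jumps

/-! ### Motions: restriction, uniqueness and gluing -/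

section Motions

variable {d N : ℕ} [NeZero d] {ε : ℝ} {Z : Config d N} {T T' : ℝ}
  {x vin vout x' vin' vout' : ℝ → Fin N → Vec d}

theorem IsMotion.step (h : IsMotion ε Z T x vin vout) {s t : ℝ} (hs : 0 ≤ s) (hst : s < t)
    (ht : t ≤ T)
    (hno : ∀ u ∈ Ioo s t, u ∉ {t | t ∈ Ico 0 T ∧ ∃ i, HasEvent ε (x t) (vin t) i}) :
    x t = x s + (t - s) • vout s ∧ vin t = vout s := by
  have key : ∀ i, x t i = x s i + (t - s) • vout s i ∧ vin t i = vout s i := fun i =>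
    h.free_flight i s t hs hst ht fun u hu he =>
      hno u hu ⟨⟨hs.trans hu.1.le, hu.2.trans_le ht⟩, i, he⟩
  exact ⟨funext fun i => (key i).1, funext fun i => (key i).2⟩

/-- A transitive relation between times holds along a motion if it holds along free flights. -/
theorem IsMotion.rel (h : IsMotion ε Z T x vin vout) {P : ℝ → ℝ → Prop} {a : ℝ} (ha : 0 ≤ a)
    (hstep : ∀ s t, a ≤ s → s < t → t ≤ T → x t = x s + (t - s) • vout s → vin t = vout s → P s t)
    (htrans : ∀ s u t, a ≤ s → s < u → u < t → t ≤ T → P s u → P u t → P s t)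
    {s t : ℝ} (hs : a ≤ s) (hst : s < t) (ht : t ≤ T) : P s t :=
  rel_of_finite h.finite_events
    (fun s t hs hst ht hno => by
      obtain ⟨h1, h2⟩ := h.step (ha.trans hs) hst ht hno
      exact hstep s t hs hst ht h1 h2)
    htrans hs hst ht

theorem IsMotion.restrict (h : IsMotion ε Z T x vin vout) (h0 : 0 ≤ T') (hT : T' ≤ T) :
    IsMotion ε Z T' x vin vout where
  nonneg := h0
  init_pos := h.init_pos
  init_vel := h.init_vel
  mem_phaseSpace _ ht := h.mem_phaseSpace _ ⟨ht.1, ht.2.trans hT⟩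
  finite_events := h.finite_events.subset fun _ ht => ⟨⟨ht.1.1, ht.1.2.trans_le hT⟩, ht.2⟩
  not_simultaneous _ ht := h.not_simultaneous _ ⟨ht.1, ht.2.trans_le hT⟩
  outgoing _ ht := h.outgoing _ ⟨ht.1, ht.2.trans_le hT⟩
  free_flight i s t hs hst ht := h.free_flight i s t hs hst (ht.trans hT)

theorem IsMotion.congr (h : IsMotion ε Z T x vin vout) (hx : EqOn x' x (Icc 0 T))
    (hi : EqOn vin' vin (Icc 0 T)) (ho : EqOn vout' vout (Ico 0 T)) :
    IsMotion ε Z T x' vin' vout' where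
  nonneg := h.nonneg
  init_pos := by rw [hx ⟨le_rfl, h.nonneg⟩, h.init_pos]
  init_vel := by rw [hi ⟨le_rfl, h.nonneg⟩, h.init_vel]
  mem_phaseSpace t ht := by rw [hx ht, hi ht]; exact h.mem_phaseSpace t ht
  finite_events := h.finite_events.subset fun _ ht => ⟨ht.1, by
    rw [← hx (Ico_subset_Icc_self ht.1), ← hi (Ico_subset_Icc_self ht.1)]; exact ht.2⟩
  not_simultaneous t ht := by
    rw [hx (Ico_subset_Icc_self ht), hi (Ico_subset_Icc_self ht)]; exact h.not_simultaneous t ht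
  outgoing t ht := by
    rw [hx (Ico_subset_Icc_self ht), hi (Ico_subset_Icc_self ht), ho ht]; exact h.outgoing t ht
  free_flight i s t hs hst ht hno := by
    rw [hx ⟨hs.trans hst.le, ht⟩, hi ⟨hs.trans hst.le, ht⟩, hx ⟨hs, hst.le.trans ht⟩,
      ho ⟨hs, hst.trans_le ht⟩]
    refine h.free_flight i s t hs hst ht fun u hu => ?_
    have hu' : u ∈ Icc 0 T := ⟨hs.trans hu.1.le, hu.2.le.trans ht⟩
    rw [← hx hu', ← hi hu']
    exact hno u hu

theorem IsMotion.unique (h : IsMotion ε Z T x vin vout) (h' : IsMotion ε Z T x' vin' vout') :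
    EqOn x' x (Icc 0 T) ∧ EqOn vin' vin (Icc 0 T) ∧ EqOn vout' vout (Ico 0 T) := by
  have key : ∀ t, 0 ≤ t → t ≤ T → x' t = x t ∧ vin' t = vin t := by
    intro t h0 ht
    have hinit : x' 0 = x 0 ∧ vin' 0 = vin 0 :=
      ⟨by rw [h.init_pos, h'.init_pos], by rw [h.init_vel, h'.init_vel]⟩
    rcases h0.eq_or_lt with rfl | h0
    · exact hinit
    · refine rel_of_finite (E := _ ∪ _) (h.finite_events.union h'.finite_events)
        -- Agreement at one time is not a relation between two times; its propagation from `s` to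
        -- `t` is, and it is transitive.
        (P := fun s t => (x' s = x s ∧ vin' s = vin s) → (x' t = x t ∧ vin' t = vin t))
        (fun s t hs hst ht hno => ?_) (fun s u t _ _ _ _ hsu hut he => hut (hsu he))
        le_rfl h0 ht hinit
      rintro ⟨hx, hv⟩
      obtain ⟨h1, h2⟩ := h.step hs hst ht fun u hu hu' => hno u hu (Or.inl hu')
      obtain ⟨h3, h4⟩ := h'.step hs hst ht fun u hu hu' => hno u hu (Or.inr hu')
      have ho' := h'.outgoing s ⟨hs, hst.trans_le ht⟩
      rw [hx, hv] at ho'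
      have := outgoing_unique (h.outgoing s ⟨hs, hst.trans_le ht⟩) ho'
      rw [h1, h2, h3, h4, hx, this]
      exact ⟨rfl, rfl⟩
  refine ⟨fun t ht => (key t ht.1 ht.2).1, fun t ht => (key t ht.1 ht.2).2, fun t ht => ?_⟩
  have ho' := h'.outgoing t ht
  rw [(key t ht.1 ht.2.le).1, (key t ht.1 ht.2.le).2] at ho'
  exact outgoing_unique ho' (h.outgoing t ht)

/-- The motion on the times of a set of existence times without a largest element. -/
theorem exists_common_motion {S : Set ℝ}
    (h0 : ∀ T ∈ S, 0 ≤ T) (hS : ∀ T ∈ S, ∃ T' ∈ S, T < T') (hm : ∀ T ∈ S, ∃ x vin vout, IsMotion ε Z T x vin vout)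
    (hd : ∀ T ∈ S, ∀ t, 0 ≤ t → t ≤ T → t ∈ S) :
    ∃ x vin vout, ∀ T ∈ S, IsMotion ε Z T x vin vout := by
  have H : ∀ T : ℝ, ∃ T' : ℝ, ∃ x vin vout, T ∈ S → T < T' ∧ IsMotion ε Z T' x vin vout := by
    intro T
    by_cases hT : T ∈ S
    · obtain ⟨T', hT', hlt⟩ := hS T hT
      obtain ⟨x, vin, vout, h⟩ := hm T' hT'
      exact ⟨T', x, vin, vout, fun _ => ⟨hlt, h⟩⟩
    · exact ⟨0, fun _ => 0, fun _ => 0, fun _ => 0, fun h => (hT h).elim⟩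
  choose τ x vin vout hτ using H
  -- At each time the motion chosen for that time is read. It lasts strictly beyond `t`, which is
  -- needed because a motion determines `vout` only before its final time.
  refine ⟨fun t => x t t, fun t => vin t t, fun t => vout t t, fun T hT => ?_⟩
  have hT' := (hτ T hT).2.restrict (h0 T hT) (hτ T hT).1.le
  have key : ∀ t ∈ Icc 0 T, x t t = x T t ∧ vin t t = vin T t ∧ (t < T → vout t t = vout T t) := by
    intro t ht
    have htS := hd T hT t ht.1 ht.2
    obtain ⟨hlt, hmt⟩ := hτ t htS
    set m := min (τ t) T
    have h1 := hmt.restrict (T' := m) (le_min hmt.nonneg (ht.1.trans ht.2)) (min_le_left _ _)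
    have h2 := hT'.restrict (T' := m) (le_min hmt.nonneg (ht.1.trans ht.2)) (min_le_right _ _)
    obtain ⟨u1, u2, u3⟩ := h2.unique h1
    have htm : t ≤ m := le_min hlt.le ht.2
    exact ⟨u1 ⟨ht.1, htm⟩, u2 ⟨ht.1, htm⟩, fun h => u3 ⟨ht.1, lt_min hlt h⟩⟩
  exact hT'.congr (fun t ht => (key t ht).1) (fun t ht => (key t ht).2.1)
    (fun t ht => (key t ⟨ht.1, ht.2.le⟩).2.2 ht.2)

end Motions

/-! ### Limits and contacts near a limiting time -/

theorem exists_Ioo_of_finite {E : Set ℝ} (hE : E.Finite) (s : ℝ) :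
    ∃ l u, l < s ∧ s < u ∧ ∀ t ∈ Ioo l u, t ≠ s → t ∉ E := by
  have h : (E \ {s})ᶜ ∈ 𝓝 s :=
    (hE.subset sdiff_subset).isClosed.isOpen_compl.mem_nhds (by simp)
  obtain ⟨l, u, hs, hsub⟩ := mem_nhds_iff_exists_Ioo_subset.1 h
  exact ⟨l, u, hs.1, hs.2, fun t ht hts htE => hsub ht ⟨htE, hts⟩⟩

theorem exists_tendsto_of_norm_sub_le {F : Type*} [NormedAddCommGroup F] [CompleteSpace F]
    {f : ℝ → F} {g : ℝ → ℝ} {b L : ℝ} (hb : 0 < b) (hg : Filter.Tendsto g (𝓝[<] b) (𝓝 L))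
    (hfg : ∀ s t, 0 ≤ s → s < t → t < b → ‖f t - f s‖ ≤ g t - g s) :
    ∃ l, Filter.Tendsto f (𝓝[<] b) (𝓝 l) := by
  rw [← cauchy_map_iff_exists_tendsto, Metric.cauchy_iff]
  refine ⟨inferInstance, fun η hη => ?_⟩
  have h1 : ∀ᶠ t in 𝓝[<] b, dist (g t) L < η / 2 := hg (Metric.ball_mem_nhds L (half_pos hη))
  have h2 : ∀ᶠ t in 𝓝[<] b, t ∈ Ioo 0 b := Ioo_mem_nhdsLT hb
  refine ⟨f '' {t | dist (g t) L < η / 2 ∧ t ∈ Ioo 0 b}, Filter.image_mem_map (h1.and h2), ?_⟩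
  have key : ∀ s t, dist (g s) L < η / 2 → dist (g t) L < η / 2 → 0 ≤ s → s < t → t < b →
      ‖f t - f s‖ < η := by
    intro s t hs ht h0 hst htb
    refine (hfg s t h0 hst htb).trans_lt ?_
    rw [Real.dist_eq, abs_lt] at hs ht
    linarith [hs.1, ht.2]
  rintro _ ⟨s, ⟨hs, hs'⟩, rfl⟩ _ ⟨t, ⟨ht, ht'⟩, rfl⟩
  rcases lt_trichotomy s t with hst | rfl | hst
  · rw [dist_eq_norm, norm_sub_rev]
    exact key s t hs ht hs'.1.le hst ht'.2
  · simpa using hη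
  · rw [dist_eq_norm]
    exact key t s ht hs ht'.1.le hst hs'.2

section Asymptotics

variable {F : Type*} [NormedAddCommGroup F] [InnerProductSpace ℝ F]

/-- If contacts occur arbitrarily close to `b`, the limit `y'` is a contact too. Dividing the
difference of the two squared norms by `b - t` gives `inner ℝ y' w = 0`. Then `inner ℝ (y t) w` is
`-(b - t)` times a quantity tending to the square norm of `w`. -/
theorem eventually_inner_le_of_norm_eq {y q : ℝ → F} {y' w : F} {b ε : ℝ}
    (hq : Filter.Tendsto q (𝓝[<] b) (𝓝 w)) (hy : ∀ t < b, y t = y' - (b - t) • q t) :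
    ∀ᶠ t in 𝓝[<] b, ‖y t‖ = ε → inner ℝ (y t) w ≤ 0 := by
  by_cases hf : ∃ᶠ t in 𝓝[<] b, ‖y t‖ = ε
  swap
  · filter_upwards [Filter.not_frequently.1 hf] with t ht h using (ht h).elim
  have hlt : ∀ᶠ t in 𝓝[<] b, t < b := self_mem_nhdsWithin
  have hb : Filter.Tendsto (fun t => b - t) (𝓝[<] b) (𝓝 0) := by
    have : Filter.Tendsto (fun t => b - t) (𝓝 b) (𝓝 (b - b)) :=
      (continuous_const.sub continuous_id).tendsto b
    rw [sub_self] at this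
    exact this.mono_left nhdsWithin_le_nhds
  have hyl : Filter.Tendsto y (𝓝[<] b) (𝓝 y') := by
    have h := (tendsto_const_nhds (x := y')).sub (hb.smul hq)
    rw [zero_smul, sub_zero] at h
    exact h.congr' (hlt.mono fun t ht => (hy t ht).symm)
  have hny : ‖y'‖ = ε := by
    by_contra hne
    exact hf ((hyl.norm.eventually_ne hne).mono fun t ht => ht)
  have hyw : inner ℝ y' w = 0 := by
    by_contra hne
    have hr : Filter.Tendsto (fun t => 2 * inner ℝ (y t) (q t) + (b - t) * ‖q t‖ ^ 2)
        (𝓝[<] b) (𝓝 (2 * inner ℝ y' w + 0 * ‖w‖ ^ 2)) :=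
      ((hyl.inner hq).const_mul 2).add (hb.mul (hq.norm.pow 2))
    have hne' : 2 * inner ℝ y' w + 0 * ‖w‖ ^ 2 ≠ 0 := by simpa using hne
    refine hf (((hr.eventually_ne hne').and hlt).mono fun t ht h => ht.1 ?_)
    have e : y' = y t + (b - t) • q t := by rw [hy t ht.2]; abel
    have e2 : ‖y'‖ ^ 2 = ‖y t‖ ^ 2 + (b - t) * (2 * inner ℝ (y t) (q t) + (b - t) * ‖q t‖ ^ 2) := by
      rw [e, norm_add_sq_real, inner_smul_right, norm_smul, mul_pow, Real.norm_eq_abs, sq_abs]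
      ring
    rw [hny, h] at e2
    have : (b - t) * (2 * inner ℝ (y t) (q t) + (b - t) * ‖q t‖ ^ 2) = 0 := by linarith
    exact (mul_eq_zero.1 this).resolve_left (sub_pos.2 ht.2).ne'
  have hqw : ∀ᶠ t in 𝓝[<] b, 0 ≤ inner ℝ (q t) w := by
    by_cases hw : w = 0
    · simp [hw]
    · have h : Filter.Tendsto (fun t => inner ℝ (q t) w) (𝓝[<] b) (𝓝 (inner ℝ w w)) :=
        hq.inner tendsto_const_nhds
      exact (h.eventually_const_lt (real_inner_self_pos.2 hw)).mono fun t ht => ht.le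
  filter_upwards [hqw, hlt] with t ht htb _
  rw [hy t htb, inner_sub_left, real_inner_smul_left, hyw]
  nlinarith [mul_nonneg (sub_pos.2 htb).le ht]

/-- The wall constraint is affine, so contacts arbitrarily close to `b` make the mean velocities
orthogonal to `e`, and hence their limit. -/
theorem eventually_inner_eq_zero_of_inner_eq {y q : ℝ → F} {y' w e : F} {b c : ℝ}
    (hq : Filter.Tendsto q (𝓝[<] b) (𝓝 w)) (hy : ∀ t < b, y t = y' - (b - t) • q t) :
    ∀ᶠ t in 𝓝[<] b, inner ℝ (y t) e = c → inner ℝ w e = 0 := by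
  by_cases hf : ∃ᶠ t in 𝓝[<] b, inner ℝ (y t) e = c
  swap
  · filter_upwards [Filter.not_frequently.1 hf] with t ht h using (ht h).elim
  have hlt : ∀ᶠ t in 𝓝[<] b, t < b := self_mem_nhdsWithin
  have hb : Filter.Tendsto (fun t => b - t) (𝓝[<] b) (𝓝 0) := by
    have : Filter.Tendsto (fun t => b - t) (𝓝 b) (𝓝 (b - b)) :=
      (continuous_const.sub continuous_id).tendsto b
    rw [sub_self] at this
    exact this.mono_left nhdsWithin_le_nhds
  have hyl : Filter.Tendsto y (𝓝[<] b) (𝓝 y') := by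
    have h := (tendsto_const_nhds (x := y')).sub (hb.smul hq)
    rw [zero_smul, sub_zero] at h
    exact h.congr' (hlt.mono fun t ht => (hy t ht).symm)
  have hny : inner ℝ y' e = c := by
    by_contra hne
    exact hf (((hyl.inner tendsto_const_nhds).eventually_ne hne).mono fun t ht => ht)
  refine Filter.Eventually.of_forall fun _ _ => ?_
  by_contra hne
  refine hf ((((hq.inner (tendsto_const_nhds (x := e))).eventually_ne hne).and hlt).mono
    fun t ht h => ht.1 ?_)
  beta_reduce at h
  rw [hy t ht.2, inner_sub_left, real_inner_smul_left, hny] at h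
  have : (b - t) * inner ℝ (q t) e = 0 := by linarith
  exact (mul_eq_zero.1 this).resolve_left (sub_pos.2 ht.2).ne'

end Asymptotics

/-! ### Energy and virial along a motion -/

section Motions

variable {d N : ℕ} [NeZero d] {ε : ℝ} {Z : Config d N} {T : ℝ}
  {x vin vout : ℝ → Fin N → Vec d}

theorem IsMotion.energy (hε : 0 < ε) (h : IsMotion ε Z T x vin vout) {t : ℝ} (ht : t ∈ Icc 0 T) :
    ∑ i, ‖vin t i‖ ^ 2 = ∑ i, ‖Z.2 i‖ ^ 2 := by
  rw [← h.init_vel]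
  rcases ht.1.eq_or_lt with rfl | h0
  · rfl
  refine h.rel (P := fun s t => ∑ i, ‖vin t i‖ ^ 2 = ∑ i, ‖vin s i‖ ^ 2) le_rfl
    (fun s t hs hst htT _ hv => ?_) (fun _ _ _ _ _ _ _ h1 h2 => h2.trans h1) le_rfl h0 ht.2
  have hsT : s ∈ Ico 0 T := ⟨hs, hst.trans_le htT⟩
  rw [hv]
  exact sum_norm_sq_outgoing hε (h.not_simultaneous s hsT) (h.outgoing s hsT)

theorem IsMotion.norm_vin_le (hε : 0 < ε) (h : IsMotion ε Z T x vin vout) {t : ℝ}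
    (ht : t ∈ Icc 0 T) (i : Fin N) : ‖vin t i‖ ≤ √(∑ i, ‖Z.2 i‖ ^ 2) := by
  refine Real.le_sqrt_of_sq_le ?_
  rw [← h.energy hε ht]
  exact Finset.single_le_sum (f := fun i => ‖vin t i‖ ^ 2) (fun _ _ => sq_nonneg _)
    (Finset.mem_univ i)

/-- A mean value inequality for piecewise linear trajectories, obtained by adding up free flights.
It is used with `c = 0` for bounds on positions and with the limit velocity for difference
quotients. -/
theorem IsMotion.norm_sub_le (h : IsMotion ε Z T x vin vout) {a η : ℝ} (ha : 0 ≤ a) {i : Fin N}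
    {c : Vec d} (hc : ∀ u, a < u → u ≤ T → ‖vin u i - c‖ ≤ η) {s t : ℝ} (hs : a ≤ s)
    (hst : s < t) (ht : t ≤ T) : ‖x t i - x s i - (t - s) • c‖ ≤ (t - s) * η := by
  refine h.rel (P := fun s t => ‖x t i - x s i - (t - s) • c‖ ≤ (t - s) * η) ha
    (fun s t hs hst htT hx hv => ?_) (fun s u t _ _ _ _ h1 h2 => ?_) hs hst ht
  · have e : x t i - x s i - (t - s) • c = (t - s) • (vin t i - c) := by
      rw [hx, hv, Pi.add_apply, Pi.smul_apply]
      module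
    rw [e, norm_smul, Real.norm_of_nonneg (sub_pos.2 hst).le]
    exact mul_le_mul_of_nonneg_left (hc t (hs.trans_lt hst) htT) (sub_pos.2 hst).le
  · have e : x t i - x s i - (t - s) • c =
        (x t i - x u i - (t - u) • c) + (x u i - x s i - (u - s) • c) := by module
    rw [e]
    refine (norm_add_le _ _).trans ?_
    linarith

/-- The virial `∑ i, v i · x i`, corrected by its growth along free flights. -/
noncomputable def virial (E : ℝ) (x v : ℝ → Fin N → Vec d) (t : ℝ) : ℝ :=
  ∑ i, inner ℝ (v t i) (x t i) - t * E

/-- In free flight ∑ vᵢ·xᵢ grows at the rate ∑ |vᵢ|², a constant that `virial` subtracts. Only the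
jumps remain, and `norm_jump_le` applies to each. -/
theorem IsMotion.norm_vin_sub_le (hε : 0 < ε) (h : IsMotion ε Z T x vin vout) {s t : ℝ}
    (hs : 0 ≤ s) (hst : s < t) (ht : t ≤ T) (i : Fin N) :
    ‖vin t i - vin s i‖ ≤ 2 / ε * virial (∑ i, ‖Z.2 i‖ ^ 2) x vin t -
      2 / ε * virial (∑ i, ‖Z.2 i‖ ^ 2) x vin s := by
  refine h.rel (P := fun s t => ‖vin t i - vin s i‖ ≤
    2 / ε * virial (∑ i, ‖Z.2 i‖ ^ 2) x vin t - 2 / ε * virial (∑ i, ‖Z.2 i‖ ^ 2) x vin s) le_rfl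
    (fun s t hs hst htT hx hv => ?_) (fun s u t _ _ _ _ h1 h2 => ?_) hs hst ht
  · have hsT : s ∈ Ico 0 T := ⟨hs, hst.trans_le htT⟩
    have hns := h.not_simultaneous s hsT
    have hout := h.outgoing s hsT
    have hE : ∑ i, ‖vout s i‖ ^ 2 = ∑ i, ‖Z.2 i‖ ^ 2 := by
      rw [sum_norm_sq_outgoing hε hns hout, h.energy hε (Ico_subset_Icc_self hsT)]
    have e : virial (∑ i, ‖Z.2 i‖ ^ 2) x vin t - virial (∑ i, ‖Z.2 i‖ ^ 2) x vin s =
        ∑ k, inner ℝ (vout s k - vin s k) (x s k) := by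
      have h1 : ∑ k, inner ℝ (vin t k) (x t k) =
          ∑ k, inner ℝ (vout s k) (x s k) + (t - s) * ∑ i, ‖Z.2 i‖ ^ 2 := by
        rw [← hE, Finset.mul_sum, ← Finset.sum_add_distrib]
        refine Finset.sum_congr rfl fun k _ => ?_
        rw [hx, hv, Pi.add_apply, Pi.smul_apply, inner_add_right, inner_smul_right,
          real_inner_self_eq_norm_sq]
      simp only [virial, h1, inner_sub_left, Finset.sum_sub_distrib]
      ring
    rw [← mul_sub, e, hv]
    exact norm_jump_le hε hns hout i
  · have e : vin t i - vin s i = (vin t i - vin u i) + (vin u i - vin s i) := by abel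
    rw [e]
    exact (norm_add_le _ _).trans (by linarith)

end Motions

/-! ### Non-accumulation of events -/

theorem tendsto_slope_of_norm_sub_le {F : Type*} [NormedAddCommGroup F] [NormedSpace ℝ F]
    {x : ℝ → F} {x' v' : F} {b : ℝ} (hx : Filter.Tendsto x (𝓝[<] b) (𝓝 x'))
    (h : ∀ η > 0, ∃ a, 0 ≤ a ∧ a < b ∧
      ∀ s t, a < s → s < t → t < b → ‖x t - x s - (t - s) • v'‖ ≤ (t - s) * η) :
    Filter.Tendsto (fun t => (b - t)⁻¹ • (x' - x t)) (𝓝[<] b) (𝓝 v') := by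
  rw [Metric.tendsto_nhds]
  intro η hη
  obtain ⟨a, ha0, hab, ha⟩ := h (η / 2) (half_pos hη)
  filter_upwards [Ioo_mem_nhdsLT hab] with s hs
  have hpos : 0 < b - s := sub_pos.2 hs.2
  have hid : Filter.Tendsto (fun t : ℝ => t) (𝓝[<] b) (𝓝 b) := nhdsWithin_le_nhds
  have hlim : ‖x' - x s - (b - s) • v'‖ ≤ (b - s) * (η / 2) := by
    refine le_of_tendsto_of_tendsto (b := 𝓝[<] b)
      (((hx.sub_const (x s)).sub ((hid.sub_const s).smul_const v')).norm)
      ((hid.sub_const s).mul_const (η / 2)) ?_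
    filter_upwards [Ioo_mem_nhdsLT hs.2] with t ht
    exact ha s t hs.1 ht.1 ht.2
  have e : (b - s)⁻¹ • (x' - x s) - v' = (b - s)⁻¹ • (x' - x s - (b - s) • v') := by
    rw [smul_sub _ (x' - x s), inv_smul_smul₀ hpos.ne']
  rw [dist_eq_norm, e, norm_smul, Real.norm_of_nonneg (inv_pos.2 hpos).le]
  calc (b - s)⁻¹ * ‖x' - x s - (b - s) • v'‖ ≤ (b - s)⁻¹ * ((b - s) * (η / 2)) :=
        mul_le_mul_of_nonneg_left hlim (inv_pos.2 hpos).le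
    _ = η / 2 := by field_simp
    _ < η := half_lt_self hη

section Motions

variable {d N : ℕ} [NeZero d] {ε : ℝ} {Z : Config d N} {b : ℝ}
  {x vin vout : ℝ → Fin N → Vec d}

/-- The corrected virial is nondecreasing, since its increments dominate norms, and bounded, since
energy bounds velocities and positions. It converges, and the velocities are Cauchy with it. -/
theorem tendsto_vin_of_forall_lt [Nonempty (Fin N)] (hε : 0 < ε) (hb : 0 < b)
    (h : ∀ T, 0 ≤ T → T < b → IsMotion ε Z T x vin vout) :
    ∃ v' : Fin N → Vec d, ∀ i, Filter.Tendsto (fun t => vin t i) (𝓝[<] b) (𝓝 (v' i)) := by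
  set E := ∑ i, ‖Z.2 i‖ ^ 2
  have hle : ∀ s t, 0 ≤ s → s < t → t < b → ∀ i,
      ‖vin t i - vin s i‖ ≤ 2 / ε * virial E x vin t - 2 / ε * virial E x vin s :=
    fun s t hs hst ht i =>
      (h t (hs.trans hst.le) ht).norm_vin_sub_le hε hs hst le_rfl i
  have hmono : MonotoneOn (fun t => 2 / ε * virial E x vin t) (Ioo 0 b) := by
    intro s hs t ht hst
    rcases hst.eq_or_lt with rfl | hst
    · exact le_rfl
    · exact sub_nonneg.1 ((norm_nonneg _).trans
        (hle s t hs.1.le hst ht.2 (Classical.arbitrary (Fin N))))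
  have hpos : ∀ t, 0 < t → t < b → ∀ i, ‖x t i‖ ≤ ‖Z.1 i‖ + b * √E := by
    intro t h0 ht i
    have hm := h t h0.le ht
    have h1 := hm.norm_sub_le (c := 0) (η := √E) (i := i) le_rfl
      (fun u hu hut => by rw [sub_zero]; exact hm.norm_vin_le hε ⟨hu.le, hut⟩ i) le_rfl h0 le_rfl
    rw [smul_zero, sub_zero, sub_zero, hm.init_pos] at h1
    calc ‖x t i‖ = ‖Z.1 i + (x t i - Z.1 i)‖ := by rw [add_sub_cancel]
      _ ≤ ‖Z.1 i‖ + t * √E := (norm_add_le _ _).trans (add_le_add_right h1 _)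
      _ ≤ ‖Z.1 i‖ + b * √E :=
        add_le_add_right (mul_le_mul_of_nonneg_right ht.le (Real.sqrt_nonneg _)) _
  have hbdd : BddAbove ((fun t => 2 / ε * virial E x vin t) '' Ioo 0 b) := by
    refine ⟨2 / ε * ∑ i, √E * (‖Z.1 i‖ + b * √E), ?_⟩
    rintro _ ⟨t, ht, rfl⟩
    refine mul_le_mul_of_nonneg_left ?_ (by positivity)
    have hE : 0 ≤ E := Finset.sum_nonneg fun _ _ => sq_nonneg _
    refine (sub_le_self _ (mul_nonneg ht.1.le hE)).trans (Finset.sum_le_sum fun i _ => ?_)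
    refine (real_inner_le_norm _ _).trans (mul_le_mul ?_ (hpos t ht.1 ht.2 i) (norm_nonneg _)
      (Real.sqrt_nonneg _))
    exact (h t ht.1.le ht.2).norm_vin_le hε ⟨ht.1.le, le_rfl⟩ i
  have hlim := hmono.tendsto_nhdsWithin_Ioo_left (nonempty_Ioo.2 hb) hbdd
  have H := fun i => exists_tendsto_of_norm_sub_le (f := fun t => vin t i) hb hlim
    fun s t hs hst ht => hle s t hs hst ht i
  choose v' hv' using H
  exact ⟨v', hv'⟩

theorem tendsto_pos_of_forall_lt (hε : 0 < ε) (hb : 0 < b)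
    (h : ∀ T, 0 ≤ T → T < b → IsMotion ε Z T x vin vout) :
    ∃ x' : Fin N → Vec d, ∀ i, Filter.Tendsto (fun t => x t i) (𝓝[<] b) (𝓝 (x' i)) := by
  set E := ∑ i, ‖Z.2 i‖ ^ 2
  have hid : Filter.Tendsto (fun t : ℝ => t * √E) (𝓝[<] b) (𝓝 (b * √E)) :=
    Filter.Tendsto.mul_const _ nhdsWithin_le_nhds
  have H := fun i => exists_tendsto_of_norm_sub_le (f := fun t => x t i) hb hid
    fun s t hs hst ht => by
      have hm := h t (hs.trans hst.le) ht
      have h1 := hm.norm_sub_le (c := 0) (η := √E) (i := i) le_rfl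
        (fun u hu hut => by rw [sub_zero]; exact hm.norm_vin_le hε ⟨hu.le, hut⟩ i) hs hst le_rfl
      rw [smul_zero, sub_zero] at h1
      linarith
  choose x' hx' using H
  exact ⟨x', hx'⟩

/-- Events do not accumulate in finite time. -/
theorem finite_events_of_forall_lt [Nonempty (Fin N)] (hε : 0 < ε) (hb : 0 < b)
    (h : ∀ T, 0 ≤ T → T < b → IsMotion ε Z T x vin vout) :
    {t | t ∈ Ico 0 b ∧ ∃ i, HasEvent ε (x t) (vin t) i}.Finite := by
  obtain ⟨v', hv'⟩ := tendsto_vin_of_forall_lt hε hb h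
  obtain ⟨x', hx'⟩ := tendsto_pos_of_forall_lt hε hb h
  -- The mean velocity between `t` and `b` has the same limit as the velocity, which supplies the
  -- first-order expansion used to analyse contacts.
  have hq : ∀ i, Filter.Tendsto (fun t => (b - t)⁻¹ • (x' i - x t i)) (𝓝[<] b) (𝓝 (v' i)) := by
    intro i
    refine tendsto_slope_of_norm_sub_le (hx' i) fun η hη => ?_
    have h1 : ∀ᶠ t in 𝓝[<] b, dist (vin t i) (v' i) < η := hv' i (Metric.ball_mem_nhds _ hη)
    obtain ⟨a, hab, ha⟩ := (mem_nhdsLT_iff_exists_Ioo_subset' hb).1 h1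
    refine ⟨max a 0, le_max_right _ _, max_lt hab hb, fun s t hs hst ht => ?_⟩
    have h0 : 0 ≤ t := (le_max_right a 0).trans (hs.trans hst).le
    refine (h t h0 ht).norm_sub_le (le_max_right _ _) (fun u hu hut => ?_) hs.le hst le_rfl
    rw [← dist_eq_norm]
    exact (ha ⟨(le_max_left _ _).trans_lt hu, hut.trans_lt ht⟩).le
  have hxq : ∀ i, ∀ t < b, x t i = x' i - (b - t) • ((b - t)⁻¹ • (x' i - x t i)) := by
    intro i t ht
    rw [smul_inv_smul₀ (sub_pos.2 ht).ne', sub_sub_cancel]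
  have hpair : ∀ i j, ∀ᶠ t in 𝓝[<] b, ‖x t i - x t j‖ = ε →
      inner ℝ (x t i - x t j) (v' i - v' j) ≤ 0 := by
    intro i j
    refine eventually_inner_le_of_norm_eq (y := fun t => x t i - x t j) (y' := x' i - x' j)
      ((hq i).sub (hq j)) fun t ht => ?_
    beta_reduce
    rw [smul_sub, smul_inv_smul₀ (sub_pos.2 ht).ne', smul_inv_smul₀ (sub_pos.2 ht).ne']
    abel
  have hwall : ∀ i, ∀ᶠ t in 𝓝[<] b, inner ℝ (x t i) (e₁ d) = ε / 2 →
      inner ℝ (v' i) (e₁ d) = 0 := fun i =>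
    eventually_inner_eq_zero_of_inner_eq (hq i) (hxq i)
  have hev := (Filter.eventually_all.2 fun i => Filter.eventually_all.2 (hpair i)).and
    (Filter.eventually_all.2 hwall)
  obtain ⟨a', hab', ha'⟩ := (mem_nhdsLT_iff_exists_Ioo_subset' hb).1 hev
  obtain ⟨a, ha0, ha'a, hab⟩ : ∃ a, 0 < a ∧ a' < a ∧ a < b := by
    obtain ⟨a, h1, h2⟩ := exists_between (max_lt hab' hb)
    exact ⟨a, (le_max_right _ _).trans_lt h1, (le_max_left _ _).trans_lt h1, h2⟩
  -- the component of the velocities along their limit does not increase near `b`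
  have hdec : ∀ s t, a ≤ s → s < t → t < b →
      ∑ i, inner ℝ (vin t i) (v' i) ≤ ∑ i, inner ℝ (vin s i) (v' i) := by
    intro s t hs hst ht
    refine (h t (ha0.le.trans (hs.trans hst.le)) ht).rel
      (P := fun s t => ∑ i, inner ℝ (vin t i) (v' i) ≤ ∑ i, inner ℝ (vin s i) (v' i)) ha0.le
      (fun s u hs hsu hut _ hv => ?_) (fun _ _ _ _ _ _ _ h1 h2 => h2.trans h1) hs hst le_rfl
    have hm := h u (ha0.le.trans (hs.trans hsu.le)) (hut.trans_lt ht)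
    have hsT : s ∈ Ico 0 u := ⟨ha0.le.trans hs, hsu⟩
    have hj := sum_inner_jump (hm.not_simultaneous s hsT) (hm.outgoing s hsT) v'
    simp only [inner_sub_left (vout s _), Finset.sum_sub_distrib] at hj
    obtain ⟨hp, hw⟩ := ha' ⟨ha'a.trans_le hs, hsu.trans (hut.trans_lt ht)⟩
    have h1 : ∑ i, ∑ j, kick ε (x s) (vin s) i j * inner ℝ (x s i - x s j) (v' i - v' j) ≤ 0 := by
      refine Finset.sum_nonpos fun i _ => Finset.sum_nonpos fun j _ => ?_
      by_cases hk : kick ε (x s) (vin s) i j = 0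
      · rw [hk, zero_mul]
      · exact mul_nonpos_of_nonneg_of_nonpos (kick_nonneg i j)
          (hp i j (collides_of_kick_ne_zero hk).1.2)
    have h2 : ∑ i, wallKick ε (x s) (vin s) i * inner ℝ (e₁ d) (v' i) = 0 := by
      refine Finset.sum_eq_zero fun i _ => ?_
      by_cases hk : wallKick ε (x s) (vin s) i = 0
      · rw [hk, zero_mul]
      · rw [real_inner_comm, hw i (bounces_of_wallKick_ne_zero hk).1, mul_zero]
    rw [hv]
    linarith
  have hE' : ∑ i, ‖v' i‖ ^ 2 = ∑ i, ‖Z.2 i‖ ^ 2 := by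
    refine tendsto_nhds_unique (tendsto_finsetSum _ fun i _ => (hv' i).norm.pow 2)
      (tendsto_const_nhds.congr' ?_)
    filter_upwards [Ioo_mem_nhdsLT hb] with t ht
    exact ((h t ht.1.le ht.2).energy hε ⟨ht.1.le, le_rfl⟩).symm
  -- A nonincreasing quantity stays above its limit. Together with equal energies this is the
  -- equality case of Cauchy–Schwarz.
  have hconst : ∀ s, a ≤ s → s < b → vin s = v' := by
    intro s hs hsb
    have h1 : ∑ i, inner ℝ (v' i) (v' i) ≤ ∑ i, inner ℝ (vin s i) (v' i) := by
      refine le_of_tendsto (x := 𝓝[<] b)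
        (tendsto_finsetSum _ fun i _ => (hv' i).inner (tendsto_const_nhds (x := v' i))) ?_
      filter_upwards [Ioo_mem_nhdsLT hsb] with t ht
      exact hdec s t hs ht.1 ht.2
    have h2 := (h s (ha0.le.trans hs) hsb).energy hε ⟨ha0.le.trans hs, le_rfl⟩
    simp only [real_inner_self_eq_norm_sq] at h1
    have h3 : ∑ i, ‖vin s i - v' i‖ ^ 2 ≤ 0 := by
      simp only [norm_sub_sq_real, Finset.sum_add_distrib, Finset.sum_sub_distrib,
        ← Finset.mul_sum]
      linarith
    funext i
    have h4 := (Finset.single_le_sum (f := fun i => ‖vin s i - v' i‖ ^ 2)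
      (fun _ _ => sq_nonneg _) (Finset.mem_univ i)).trans h3
    have h5 := pow_eq_zero_iff (two_ne_zero) |>.1 (le_antisymm h4 (sq_nonneg _))
    exact sub_eq_zero.1 (norm_eq_zero.1 h5)
  -- An event at `s` changes the velocities, yet the outgoing ones are the arriving ones at a
  -- slightly later time, which are again `v'`.
  have hno : ∀ s, a ≤ s → s < b → ∀ i, ¬ HasEvent ε (x s) (vin s) i := by
    intro s hs hsb i hi
    obtain ⟨T, hsT, hTb⟩ := exists_between hsb
    have h0 : 0 ≤ s := ha0.le.trans hs
    have hm := h T (h0.trans hsT.le) hTb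
    obtain ⟨l, u, hl, hu, hlu⟩ := exists_Ioo_of_finite hm.finite_events s
    have hst : s < min u T := lt_min hu hsT
    have h1 := (hm.step h0 hst (min_le_right _ _) fun w hw =>
      hlu w ⟨hl.trans hw.1, hw.2.trans_le (min_le_left _ _)⟩ hw.1.ne').2
    refine outgoing_ne hε (hm.outgoing s ⟨h0, hsT⟩) hi ?_
    rw [← h1, hconst s hs hsb, hconst _ (hs.trans hst.le) ((min_le_right _ _).trans_lt hTb)]
  refine (h a ha0.le hab).finite_events.subset ?_
  rintro t ⟨ht, i, hi⟩
  refine ⟨⟨ht.1, ?_⟩, i, hi⟩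
  by_contra hta
  exact hno t (not_lt.1 hta) ht.2 i hi

end Motions

/-! ### Continuation and global existence -/

section Extension

variable {d N : ℕ} [NeZero d] {ε : ℝ}

theorem isClosed_phaseSpace : IsClosed (phaseSpace d N ε) := by
  have h : phaseSpace d N ε =
      (⋂ i, {Z | ε / 2 ≤ inner ℝ (Z.1 i) (e₁ d)}) ∩
        ⋂ j, ⋂ k, ⋂ _ : j < k, {Z | ε ≤ ‖Z.1 j - Z.1 k‖} := by
    ext Z
    simp [phaseSpace]
  rw [h]
  refine (isClosed_iInter fun i => isClosed_le continuous_const (by fun_prop)).inter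
    (isClosed_iInter fun j => isClosed_iInter fun k => isClosed_iInter fun _ =>
      isClosed_le continuous_const (by fun_prop))

theorem norm_sub_ge_of_mem_phaseSpace {Z : Config d N} (hZ : Z ∈ phaseSpace d N ε) {i j : Fin N}
    (hij : i ≠ j) : ε ≤ ‖Z.1 i - Z.1 j‖ := by
  rcases hij.lt_or_gt with h | h
  · exact hZ.2 i j h
  · rw [norm_sub_rev]
    exact hZ.2 j i h

theorem SimultaneousEvents.hasEvent {x v : Fin N → Vec d} {i : Fin N}
    (h : SimultaneousEvents ε x v i) : HasEvent ε x v i := by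
  rcases h with h | h | ⟨j, k, _, h, _⟩
  · exact Or.inl h.1
  · exact Or.inr h.2
  · exact Or.inr ⟨j, h⟩

/-- Two touching particles either collide, which reverses the sign, or have no event at all: any
other event would be a second contact. The broad notion of simultaneity, with second contacts that
need not be pre-collisional, is what makes this work. -/
theorem inner_outgoing_nonneg_of_touches {x v w : Fin N → Vec d} (hε : 0 < ε)
    (hns : ∀ i, ¬ SimultaneousEvents ε x v i) (hw : IsOutgoing ε x v w) {i j : Fin N}
    (h : Touches ε x i j) : 0 ≤ inner ℝ (x i - x j) (w i - w j) := by
  by_cases hc : Collides ε x v i j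
  · rw [hc.inner_out hε hw]
    linarith [hc.inner_neg]
  · have key : ∀ i j, Touches ε x i j → ¬ Collides ε x v i j → w i = v i := by
      intro i j h hc
      refine (hw i).2.2 ?_
      have hi := hns i
      simp only [SimultaneousEvents, not_or, not_and, not_exists] at hi
      rintro (hb | ⟨k, hk⟩)
      · exact hi.1 hb j h
      · by_cases hkj : k = j
        · exact hc (hkj ▸ hk)
        · exact hi.2.2 k j hkj hk h
    rw [key i j h hc, key j i h.symm fun h' => hc h'.symm]
    by_contra hneg
    refine hc ⟨h, ?_⟩
    rw [← neg_sub (x i), ← neg_sub (v i), inner_neg_neg]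
    exact not_le.1 hneg

theorem inner_outgoing_nonneg_of_touchesWall {x v w : Fin N → Vec d}
    (hns : ∀ i, ¬ SimultaneousEvents ε x v i) (hw : IsOutgoing ε x v w) {i : Fin N}
    (h : TouchesWall ε x i) : 0 ≤ inner ℝ (w i) (e₁ d) := by
  by_cases hb : Bounces ε x v i
  · rw [hb.inner_out hw]
    linarith [hb.2]
  · have hwi : w i = v i := by
      refine (hw i).2.2 ?_
      rintro (hb' | hk)
      · exact hb hb'
      · exact hns i (Or.inr (Or.inl ⟨h, hk⟩))
    rw [hwi]
    by_contra hneg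
    exact hb ⟨h, not_le.1 hneg⟩

/-- For a non-approaching contact, the distance cannot decrease and the radial velocity stays
nonnegative, even when the contact is tangential. Separated particles are handled by continuity. -/
theorem eventually_pair_free {x w : Fin N → Vec d} {i j : Fin N} (hij : i ≠ j)
    (hx : ε ≤ ‖x i - x j‖) (hw : Touches ε x i j → 0 ≤ inner ℝ (x i - x j) (w i - w j)) :
    ∀ᶠ s in 𝓝[>] (0 : ℝ), ε ≤ ‖(x + s • w) i - (x + s • w) j‖ ∧ ¬ Collides ε (x + s • w) w i j := by
  have e : ∀ s : ℝ, (x + s • w) i - (x + s • w) j = (x i - x j) + s • (w i - w j) := by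
    intro s
    simp only [Pi.add_apply, Pi.smul_apply]
    module
  rcases hx.eq_or_lt with hx | hx
  · have hyw := hw ⟨hij, hx.symm⟩
    filter_upwards [self_mem_nhdsWithin] with s (hs : 0 < s)
    constructor
    · rw [e]
      refine le_of_sq_le_sq ?_ (norm_nonneg _)
      rw [norm_add_sq_real, inner_smul_right, ← hx]
      have := mul_nonneg hs.le hyw
      nlinarith [sq_nonneg ‖s • (w i - w j)‖]
    · intro hc
      have h1 := hc.inner_neg
      rw [e, inner_add_left, real_inner_smul_left] at h1
      have := mul_nonneg hs.le (real_inner_self_nonneg (x := w i - w j))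
      linarith
  · have hc : Continuous fun s : ℝ => ‖(x + s • w) i - (x + s • w) j‖ := by
      simp only [e]
      fun_prop
    have h0 : ε < ‖(x + (0 : ℝ) • w) i - (x + (0 : ℝ) • w) j‖ := by simpa using hx
    have h1 := (hc.tendsto 0).eventually_const_lt h0
    filter_upwards [nhdsWithin_le_nhds h1] with s hs
    exact ⟨le_of_lt hs, fun hc => (ne_of_gt hs) hc.1.2⟩

theorem eventually_wall_free {x w : Fin N → Vec d} {i : Fin N}
    (hx : ε / 2 ≤ inner ℝ (x i) (e₁ d)) (hw : TouchesWall ε x i → 0 ≤ inner ℝ (w i) (e₁ d)) :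
    ∀ᶠ s in 𝓝[>] (0 : ℝ), ε / 2 ≤ inner ℝ ((x + s • w) i) (e₁ d) ∧ ¬ Bounces ε (x + s • w) w i := by
  have e : ∀ s : ℝ, inner ℝ ((x + s • w) i) (e₁ d) =
      inner ℝ (x i) (e₁ d) + s * inner ℝ (w i) (e₁ d) := by
    intro s
    rw [Pi.add_apply, Pi.smul_apply, inner_add_left, real_inner_smul_left]
  rcases hx.eq_or_lt with hx | hx
  · have hyw := hw hx.symm
    filter_upwards [self_mem_nhdsWithin] with s (hs : 0 < s)
    refine ⟨?_, fun hb => not_lt.2 hyw hb.2⟩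
    rw [e]
    have := mul_nonneg hs.le hyw
    linarith
  · have hc : Continuous fun s : ℝ => inner ℝ ((x + s • w) i) (e₁ d) := by
      simp only [e]
      fun_prop
    have h0 : ε / 2 < inner ℝ ((x + (0 : ℝ) • w) i) (e₁ d) := by simpa using hx
    have h1 := (hc.tendsto 0).eventually_const_lt h0
    filter_upwards [nhdsWithin_le_nhds h1] with s hs
    exact ⟨le_of_lt hs, fun hb => (ne_of_gt hs) hb.1⟩

theorem exists_free_flight {x v w : Fin N → Vec d} (hε : 0 < ε) (hx : (x, v) ∈ phaseSpace d N ε)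
    (hns : ∀ i, ¬ SimultaneousEvents ε x v i) (hw : IsOutgoing ε x v w) :
    ∃ δ > (0 : ℝ), ∀ s : ℝ, 0 < s → s ≤ δ →
      (x + s • w, w) ∈ phaseSpace d N ε ∧ ∀ i, ¬ HasEvent ε (x + s • w) w i := by
  have h1 : ∀ i j, ∀ᶠ s in 𝓝[>] (0 : ℝ), i ≠ j →
      ε ≤ ‖(x + s • w) i - (x + s • w) j‖ ∧ ¬ Collides ε (x + s • w) w i j := by
    intro i j
    by_cases hij : i = j
    · exact Filter.Eventually.of_forall fun s h => (h hij).elim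
    · exact (eventually_pair_free hij (norm_sub_ge_of_mem_phaseSpace hx hij)
        (inner_outgoing_nonneg_of_touches hε hns hw)).mono fun s hs _ => hs
  have h2 : ∀ i, ∀ᶠ s in 𝓝[>] (0 : ℝ), ε / 2 ≤ inner ℝ ((x + s • w) i) (e₁ d) ∧
      ¬ Bounces ε (x + s • w) w i := fun i =>
    eventually_wall_free (hx.1 i) (inner_outgoing_nonneg_of_touchesWall hns hw)
  have hev := (Filter.eventually_all.2 fun i => Filter.eventually_all.2 (h1 i)).and
    (Filter.eventually_all.2 h2)
  obtain ⟨u, hu, hsub⟩ := mem_nhdsGT_iff_exists_Ioo_subset.1 hev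
  refine ⟨u / 2, half_pos hu, fun s hs hsu => ?_⟩
  obtain ⟨hp, hq⟩ := hsub ⟨hs, hsu.trans_lt (half_lt_self hu)⟩
  refine ⟨⟨fun i => (hq i).1, fun j k hjk => (hp j k hjk.ne).1⟩, ?_⟩
  rintro i (hb | ⟨j, hj⟩)
  · exact (hq i).2 hb
  · exact (hp i j hj.1.1).2 hj

variable {Z : Config d N} {T b : ℝ} {x vin vout : ℝ → Fin N → Vec d}

theorem isMotion_of_forall_lt [Nonempty (Fin N)] (hε : 0 < ε) {s₀ : ℝ} (h0 : 0 ≤ s₀) (hb : s₀ < b)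
    (h : ∀ T, 0 ≤ T → T < b → IsMotion ε Z T x vin vout)
    (hno : ∀ u ∈ Ioo s₀ b, ∀ i, ¬ HasEvent ε (x u) (vin u) i)
    (hxb : x b = x s₀ + (b - s₀) • vout s₀) (hvb : vin b = vout s₀) :
    IsMotion ε Z b x vin vout := by
  have h0b : 0 < b := h0.trans_lt hb
  have hfree : ∀ t ∈ Ioo s₀ b, x t = x s₀ + (t - s₀) • vout s₀ ∧ vin t = vout s₀ := by
    intro t ht
    exact (h t (h0.trans ht.1.le) ht.2).step h0 ht.1 le_rfl fun u hu hu' =>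
      let ⟨i, hi⟩ := hu'.2
      hno u ⟨hu.1, hu.2.trans ht.2⟩ i hi
  refine ⟨h0b.le, (h 0 le_rfl h0b).init_pos, (h 0 le_rfl h0b).init_vel, fun t ht => ?_,
    finite_events_of_forall_lt hε h0b h, fun t ht => ?_, fun t ht => ?_, ?_⟩
  · rcases ht.2.eq_or_lt with rfl | htb
    · have hc : Continuous fun s : ℝ => (x s₀ + (s - s₀) • vout s₀, vin t) := by fun_prop
      have hlim := (hc.tendsto t).mono_left (nhdsWithin_le_nhds (s := Iio t))
      rw [hxb]
      refine isClosed_phaseSpace.mem_of_tendsto hlim ?_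
      filter_upwards [Ioo_mem_nhdsLT hb] with s hs
      have := (h s (h0.trans hs.1.le) hs.2).mem_phaseSpace s ⟨h0.trans hs.1.le, le_rfl⟩
      rw [(hfree s hs).1] at this
      exact this
    · exact (h t ht.1 htb).mem_phaseSpace t ⟨ht.1, le_rfl⟩
  · obtain ⟨T, h1, h2⟩ := exists_between ht.2
    exact (h T (ht.1.trans h1.le) h2).not_simultaneous t ⟨ht.1, h1⟩
  · obtain ⟨T, h1, h2⟩ := exists_between ht.2
    exact (h T (ht.1.trans h1.le) h2).outgoing t ⟨ht.1, h1⟩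
  · intro i s t hs hst ht hi
    rcases ht.eq_or_lt with rfl | htb
    -- The flight of particle `i` may start before or after `s₀`. It is matched at a time `m` beyond
    -- both `s` and `s₀` with the flight of the whole system from `s₀`.
    · obtain ⟨m, h1, h2⟩ := exists_between (max_lt hst hb)
      have hsm := (le_max_left s s₀).trans_lt h1
      obtain ⟨h3, h4⟩ := hfree m ⟨(le_max_right s s₀).trans_lt h1, h2⟩
      obtain ⟨h5, h6⟩ := (h m (hs.trans hsm.le) h2).free_flight i s m hs hsm le_rfl
        fun u hu => hi u ⟨hu.1, hu.2.trans h2⟩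
      have h7 : vout s₀ i = vout s i := by rw [← h4, h6]
      have h8 : x s₀ i = x s i + (m - s) • vout s i - (m - s₀) • vout s i := by
        rw [← h5, h3, Pi.add_apply, Pi.smul_apply, h7, add_sub_cancel_right]
      rw [hxb, hvb, Pi.add_apply, Pi.smul_apply, h7, h8]
      refine ⟨?_, rfl⟩
      module
    · exact (h t (hs.trans hst.le) htb).free_flight i s t hs hst le_rfl hi

theorem exists_isMotion_of_forall_lt [Nonempty (Fin N)] (hε : 0 < ε) (hb : 0 < b)
    (h : ∀ T, 0 ≤ T → T < b → IsMotion ε Z T x vin vout) :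
    ∃ x vin vout, IsMotion ε Z b x vin vout := by
  obtain ⟨l, u, hl, hu, hlu⟩ := exists_Ioo_of_finite (finite_events_of_forall_lt hε hb h) b
  obtain ⟨s₀, h1, hs₀⟩ := exists_between (max_lt hl hb)
  have h0 : 0 < s₀ := (le_max_right l 0).trans_lt h1
  have hls : l < s₀ := (le_max_left l 0).trans_lt h1
  have hx : ∀ (f : ℝ → Fin N → Vec d) y t, t < b → Function.update f b y t = f t := fun f y t ht =>
    Function.update_of_ne ht.ne _ _
  refine ⟨Function.update x b (x s₀ + (b - s₀) • vout s₀), Function.update vin b (vout s₀), vout,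
    isMotion_of_forall_lt hε h0.le hs₀ (fun T hT0 hTb => (h T hT0 hTb).congr
      (fun t ht => hx _ _ _ (ht.2.trans_lt hTb)) (fun t ht => hx _ _ _ (ht.2.trans_lt hTb))
      fun t _ => rfl) (fun t ht i => ?_) ?_ ?_⟩
  · rw [hx _ _ _ ht.2, hx _ _ _ ht.2]
    exact fun hi => hlu t ⟨hls.trans ht.1, ht.2.trans hu⟩ ht.2.ne ⟨⟨h0.le.trans ht.1.le, ht.2⟩, i, hi⟩
  · rw [Function.update_self, hx _ _ _ hs₀]
  · rw [Function.update_self]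

theorem IsMotion.exists_extension (hε : 0 < ε) (h : IsMotion ε Z T x vin vout)
    (hns : ∀ i, ¬ SimultaneousEvents ε (x T) (vin T) i) :
    ∃ T' > T, ∃ x vin vout, IsMotion ε Z T' x vin vout := by
  obtain ⟨w, hw⟩ := exists_outgoing hns
  obtain ⟨δ, hδ, hfree⟩ := exists_free_flight hε (h.mem_phaseSpace T ⟨h.nonneg, le_rfl⟩) hns hw
  set x' : ℝ → Fin N → Vec d := fun t => if t ≤ T then x t else x T + (t - T) • w
  set vin' : ℝ → Fin N → Vec d := fun t => if t ≤ T then vin t else w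
  -- The strict inequality, against the weak one for `vin'`, puts the scattering at time `T` itself:
  -- old arriving velocities, new outgoing ones.
  set vout' : ℝ → Fin N → Vec d := fun t => if t < T then vout t else w
  have hxle : ∀ t ≤ T, x' t = x t := fun t ht => if_pos ht
  have hvle : ∀ t ≤ T, vin' t = vin t := fun t ht => if_pos ht
  have holt : ∀ t < T, vout' t = vout t := fun t ht => if_pos ht
  have hxgt : ∀ t, T ≤ t → x' t = x T + (t - T) • w := by
    intro t ht
    rcases ht.eq_or_lt with rfl | ht
    · rw [hxle _ le_rfl, sub_self, zero_smul, add_zero]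
    · exact if_neg (not_le.2 ht)
  have hvgt : ∀ t, T < t → vin' t = w := fun t ht => if_neg (not_le.2 ht)
  have hoge : ∀ t, T ≤ t → vout' t = w := fun t ht => if_neg (not_lt.2 ht)
  have hafter : ∀ t, T < t → t ≤ T + δ →
      (x' t, vin' t) ∈ phaseSpace d N ε ∧ ∀ i, ¬ HasEvent ε (x' t) (vin' t) i := by
    intro t h1 h2
    rw [hxgt t h1.le, hvgt t h1]
    exact hfree (t - T) (sub_pos.2 h1) (by linarith)
  refine ⟨T + δ, by linarith, x', vin', vout', ⟨by linarith [h.nonneg], ?_, ?_, fun t ht => ?_, ?_,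
    fun t ht i => ?_, fun t ht => ?_, fun i s t hs hst ht hno => ?_⟩⟩
  · rw [hxle _ h.nonneg, h.init_pos]
  · rw [hvle _ h.nonneg, h.init_vel]
  · rcases le_or_gt t T with htT | htT
    · rw [hxle t htT, hvle t htT]
      exact h.mem_phaseSpace t ⟨ht.1, htT⟩
    · exact (hafter t htT ht.2).1
  · refine (h.finite_events.union (finite_singleton T)).subset ?_
    rintro t ⟨ht, i, hi⟩
    rcases lt_trichotomy t T with htT | htT | htT
    · rw [hxle t htT.le, hvle t htT.le] at hi
      exact Or.inl ⟨⟨ht.1, htT⟩, i, hi⟩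
    · exact Or.inr htT
    · exact ((hafter t htT ht.2.le).2 i hi).elim
  · rcases lt_trichotomy t T with htT | rfl | htT
    · rw [hxle t htT.le, hvle t htT.le]
      exact h.not_simultaneous t ⟨ht.1, htT⟩ i
    · rw [hxle t le_rfl, hvle t le_rfl]
      exact hns i
    · exact fun hi => (hafter t htT ht.2.le).2 i hi.hasEvent
  · rcases lt_trichotomy t T with htT | rfl | htT
    · rw [hxle t htT.le, hvle t htT.le, holt t htT]
      exact h.outgoing t ⟨ht.1, htT⟩
    · rw [hxle t le_rfl, hvle t le_rfl, hoge t le_rfl]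
      exact hw
    · intro i
      have hi := (hafter t htT ht.2.le).2 i
      refine ⟨fun hb => (hi (Or.inl hb)).elim, fun j hj => (hi (Or.inr ⟨j, hj⟩)).elim, fun _ => ?_⟩
      rw [hoge t htT.le, hvgt t htT]
  · rcases le_or_gt t T with htT | htT
    · rw [hxle t htT, hvle t htT, hxle s (hst.le.trans htT), holt s (hst.trans_le htT)]
      refine h.free_flight i s t hs hst htT fun u hu => ?_
      have := hno u hu
      rwa [hxle u (hu.2.le.trans htT), hvle u (hu.2.le.trans htT)] at this
    · rw [hxgt t htT.le, hvgt t htT]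
      rcases le_or_gt T s with hsT | hsT
      · rw [hxgt s hsT, hoge s hsT]
        refine ⟨?_, rfl⟩
        simp only [Pi.add_apply, Pi.smul_apply]
        module
      -- The flight of `i` crosses the junction, where `i` has no event; hence `w i` is its old
      -- velocity.
      · have hT := hno T ⟨hsT, htT⟩
        rw [hxle T le_rfl, hvle T le_rfl] at hT
        obtain ⟨h1, h2⟩ := h.free_flight i s T hs hsT le_rfl fun u hu => by
          have := hno u ⟨hu.1, hu.2.trans htT⟩
          rwa [hxle u hu.2.le, hvle u hu.2.le] at this
        have h3 : w i = vout s i := by rw [(hw i).2.2 hT, h2]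
        rw [hxle s hsT.le, holt s hsT, Pi.add_apply, Pi.smul_apply, h1, h3]
        refine ⟨?_, rfl⟩
        module

theorem isMotion_zero (hZ : Z ∈ phaseSpace d N ε) :
    IsMotion ε Z 0 (fun _ => Z.1) (fun _ => Z.2) (fun _ => Z.2) where
  nonneg := le_rfl
  init_pos := rfl
  init_vel := rfl
  mem_phaseSpace _ _ := hZ
  finite_events := by simp
  not_simultaneous t ht := by simp at ht
  outgoing t ht := by simp at ht
  free_flight i s t hs hst ht := absurd (hs.trans_lt hst) (not_lt.2 ht)

/-- The existence times form an interval from 0 without a largest element. Were it bounded, its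
supremum would belong to it, because events do not accumulate. -/
theorem globallyDefined_of_not_pathological [Nonempty (Fin N)] (hε : 0 < ε)
    (hZ : Z ∈ phaseSpace d N ε) (hp : ¬ Pathological ε Z) : GloballyDefined ε Z := by
  set S : Set ℝ := {T | ∃ x vin vout, IsMotion ε Z T x vin vout}
  have hS0 : (0 : ℝ) ∈ S := ⟨_, _, _, isMotion_zero hZ⟩
  have hSpos : ∀ T ∈ S, 0 ≤ T := fun T ⟨_, _, _, h⟩ => h.nonneg
  have hSext : ∀ T ∈ S, ∃ T' ∈ S, T < T' := by
    rintro T ⟨x, vin, vout, h⟩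
    obtain ⟨T', hT', hm⟩ := h.exists_extension hε fun i hi => hp ⟨T, x, vin, vout, h, i, hi⟩
    exact ⟨T', hm, hT'⟩
  have hSdown : ∀ T ∈ S, ∀ t, 0 ≤ t → t ≤ T → t ∈ S := by
    rintro T ⟨x, vin, vout, h⟩ t h0 ht
    exact ⟨x, vin, vout, h.restrict h0 ht⟩
  obtain ⟨x, vin, vout, hm⟩ := exists_common_motion hSpos hSext (fun T hT => hT) hSdown
  have hunb : ¬ BddAbove S := by
    intro hbdd
    obtain ⟨T₁, hT₁, h01⟩ := hSext 0 hS0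
    have hpos : 0 < sSup S := h01.trans_le (le_csSup hbdd hT₁)
    have hsup : sSup S ∈ S := exists_isMotion_of_forall_lt hε hpos fun T h0 hT => by
      obtain ⟨T', hT', hlt⟩ := exists_lt_of_lt_csSup ⟨0, hS0⟩ hT
      exact hm T (hSdown T' hT' T h0 hlt.le)
    obtain ⟨T', hT', hlt⟩ := hSext _ hsup
    exact absurd (le_csSup hbdd hT') (not_le.2 hlt)
  have hall : ∀ T, 0 ≤ T → IsMotion ε Z T x vin vout := by
    intro T hT
    obtain ⟨T', hT', hlt⟩ := not_bddAbove_iff.1 hunb T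
    exact hm T (hSdown T' hT' T hT hlt.le)
  exact ⟨x, vin, vout, hall, fun T x' vin' vout' h' => (hall T h'.nonneg).unique h'⟩

theorem not_accPt_eventTimes (h : GloballyDefined ε Z) (t : ℝ) :
    ¬ AccPt t (Filter.principal (eventTimes ε Z)) := by
  obtain ⟨x, vin, vout, hm, hu⟩ := h
  have hfin : (eventTimes ε Z ∩ Iio (|t| + 1)).Finite := by
    refine (hm (|t| + 1) (by positivity)).finite_events.subset ?_
    rintro s ⟨⟨h0, T, x', vin', vout', hsT, hm', i, hi⟩, hs⟩
    obtain ⟨h1, h2, _⟩ := hu T x' vin' vout' hm'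
    rw [h1 ⟨h0, hsT.le⟩, h2 ⟨h0, hsT.le⟩] at hi
    exact ⟨⟨h0, hs⟩, i, hi⟩
  obtain ⟨l, u, hl, hu', hlu⟩ := exists_Ioo_of_finite hfin t
  rw [accPt_iff_frequently, Filter.not_frequently]
  filter_upwards [Ioo_mem_nhds hl hu', Iio_mem_nhds (lt_of_le_of_lt (le_abs_self t)
    (lt_add_one |t|))] with s hs hs' h
  exact hlu s hs h.1 ⟨h.2, hs'⟩

end Extension

/-! ### Degenerate free flights form a null set -/

section NullSets

variable {d N : ℕ} [NeZero d] {ε : ℝ}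

instance isAddHaarMeasure_volume_config :
    Measure.IsAddHaarMeasure (volume : Measure (Config d N)) :=
  Measure.prod.instIsAddHaarMeasure _ _

/-- Fubini along the direction `(u, 0)`, which moves positions and keeps velocities. -/
theorem volume_eq_zero_of_countable_lines {A : Set (Config d N)} (hA : MeasurableSet A)
    (u : Fin N → Vec d) (h : ∀ Z : Config d N, {s : ℝ | (Z.1 + s • u, Z.2) ∈ A}.Countable) :
    volume A = 0 := by
  let L : ℝ →ₗ[ℝ] Config d N := LinearMap.toSpanSingleton ℝ _ (u, 0)
  have := ae_mem_of_ae_add_linearMap_mem L volume volume hA.compl fun Z => by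
    refine measure_mono_null (fun s hs => ?_) ((h Z).measure_zero volume)
    have e : Z + L s = (Z.1 + s • u, Z.2) := by
      ext1 <;> simp [L]
    simpa [e] using hs
  simpa [ae_iff] using this

/-- The translation keeps the time `τ` and raises particle `k` at unit speed, so each line meets the
set at most once. -/
theorem volume_touchesWall_at_eq_zero {τ : Config d N → ℝ} (hτ : Measurable τ)
    (u : Fin N → Vec d) (hu : ∀ (Z : Config d N) (s : ℝ), τ (Z.1 + s • u, Z.2) = τ Z) {k : Fin N}
    (hk : u k = e₁ d) :
    volume {Z : Config d N | TouchesWall ε (Z.1 + τ Z • Z.2) k} = 0 := by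
  have hm : Measurable fun Z : Config d N => inner ℝ ((Z.1 + τ Z • Z.2) k) (e₁ d) := by
    simp only [Pi.add_apply, Pi.smul_apply]
    fun_prop
  refine volume_eq_zero_of_countable_lines (hm (measurableSet_singleton (ε / 2))) u fun Z => ?_
  refine Set.Subsingleton.countable fun s hs t ht => ?_
  have e : ∀ r : ℝ, inner ℝ ((Z.1 + r • u + τ (Z.1 + r • u, Z.2) • Z.2) k) (e₁ d) =
      inner ℝ (Z.1 k + τ Z • Z.2 k) (e₁ d) + r := by
    intro r
    rw [hu]
    simp only [Pi.add_apply, Pi.smul_apply, hk, inner_add_left, real_inner_smul_left,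
      inner_e₁_e₁]
    ring
  have h1 : _ = ε / 2 := (e s).symm.trans hs
  have h2 : _ = ε / 2 := (e t).symm.trans ht
  linarith

theorem volume_touches_at_eq_zero {τ : Config d N → ℝ} (hτ : Measurable τ)
    (u : Fin N → Vec d) (hu : ∀ (Z : Config d N) (s : ℝ), τ (Z.1 + s • u, Z.2) = τ Z)
    {k l : Fin N} (hk : u k = e₁ d) (hl : u l = 0) :
    volume {Z : Config d N | Touches ε (Z.1 + τ Z • Z.2) k l} = 0 := by
  have hm : Measurable fun Z : Config d N =>
      ‖(Z.1 + τ Z • Z.2) k - (Z.1 + τ Z • Z.2) l‖ := by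
    simp only [Pi.add_apply, Pi.smul_apply]
    fun_prop
  have h0 : volume {Z : Config d N | ‖(Z.1 + τ Z • Z.2) k - (Z.1 + τ Z • Z.2) l‖ = ε} = 0 := by
    refine volume_eq_zero_of_countable_lines (hm (measurableSet_singleton ε)) u fun Z => ?_
    set y := Z.1 k + τ Z • Z.2 k - (Z.1 l + τ Z • Z.2 l) with hy
    have e : ∀ r : ℝ, (Z.1 + r • u + τ (Z.1 + r • u, Z.2) • Z.2) k -
        (Z.1 + r • u + τ (Z.1 + r • u, Z.2) • Z.2) l = y + r • e₁ d := by
      intro r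
      rw [hu]
      simp only [Pi.add_apply, Pi.smul_apply, hk, hl, hy]
      module
    set c := inner ℝ y (e₁ d)
    set D := √(c ^ 2 - ‖y‖ ^ 2 + ε ^ 2)
    -- A line meets a sphere in at most two points, the roots of a quadratic equation in `r`.
    refine ((Set.toFinite {-c + D, -c - D}).subset fun r hr => ?_).countable
    have hr' : ‖y + r • e₁ d‖ = ε := by
      rw [← e]
      exact hr
    have h1 : (r + c) ^ 2 = c ^ 2 - ‖y‖ ^ 2 + ε ^ 2 := by
      rw [← hr', norm_add_sq_real, inner_smul_right, norm_smul, norm_e₁, mul_one,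
        Real.norm_eq_abs, sq_abs]
      ring
    have h2 : D = |r + c| := by
      rw [← Real.sqrt_sq_eq_abs, h1]
    simp only [mem_insert_iff, mem_singleton_iff]
    rcases abs_choice (r + c) with h | h <;> rw [h] at h2
    · left; linarith
    · right; linarith
  exact measure_mono_null (fun Z hZ => hZ.2) h0

/-- The discriminant of the equation for the times at which two freely moving particles touch. -/
noncomputable def pairDisc (ε : ℝ) (i j : Fin N) (Z : Config d N) : ℝ :=
  inner ℝ (Z.1 i - Z.1 j) (Z.2 i - Z.2 j) ^ 2 -
    ‖Z.2 i - Z.2 j‖ ^ 2 * (‖Z.1 i - Z.1 j‖ ^ 2 - ε ^ 2)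

/-- The time at which two freely moving particles touch, entering if `σ = -1` and leaving
if `σ = 1`. -/
noncomputable def pairTime (ε σ : ℝ) (i j : Fin N) (Z : Config d N) : ℝ :=
  (-inner ℝ (Z.1 i - Z.1 j) (Z.2 i - Z.2 j) + σ * √(pairDisc ε i j Z)) / ‖Z.2 i - Z.2 j‖ ^ 2

/-- The time at which a freely moving particle touches the wall. -/
noncomputable def wallTime (ε : ℝ) (i : Fin N) (Z : Config d N) : ℝ :=
  (ε / 2 - inner ℝ (Z.1 i) (e₁ d)) / inner ℝ (Z.2 i) (e₁ d)

/-- Where no contact occurs the formula takes irrelevant values, but it remains measurable and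
translation invariant, which is all the null set lemmas ask of a time. -/
theorem measurable_pairTime (σ : ℝ) (i j : Fin N) :
    Measurable (pairTime (d := d) ε σ i j) := by
  unfold pairTime pairDisc
  fun_prop

theorem measurable_wallTime (i : Fin N) : Measurable (wallTime (d := d) ε i) := by
  unfold wallTime
  fun_prop

theorem pairTime_add_smul {σ : ℝ} {i j : Fin N} {u : Fin N → Vec d} (h : u i = u j)
    (Z : Config d N) (s : ℝ) :
    pairTime ε σ i j (Z.1 + s • u, Z.2) = pairTime ε σ i j Z := by
  have e : (Z.1 + s • u) i - (Z.1 + s • u) j = Z.1 i - Z.1 j := by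
    simp [h]
  simp only [pairTime, pairDisc, e]

theorem wallTime_add_smul {i : Fin N} {u : Fin N → Vec d} (h : u i = 0)
    (Z : Config d N) (s : ℝ) : wallTime ε i (Z.1 + s • u, Z.2) = wallTime ε i Z := by
  simp [wallTime, h]

/-- The discriminant is constant along the flight. At a contact it is a square, positive unless the
contact is grazing. -/
theorem pairDisc_eq_sq {i j : Fin N} {Z : Config d N} {t : ℝ}
    (h : ‖(Z.1 + t • Z.2) i - (Z.1 + t • Z.2) j‖ = ε) :
    pairDisc ε i j Z =
      inner ℝ ((Z.1 + t • Z.2) i - (Z.1 + t • Z.2) j) (Z.2 i - Z.2 j) ^ 2 := by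
  have e : (Z.1 + t • Z.2) i - (Z.1 + t • Z.2) j = (Z.1 i - Z.1 j) + t • (Z.2 i - Z.2 j) := by
    simp only [Pi.add_apply, Pi.smul_apply]
    module
  rw [e] at h ⊢
  rw [pairDisc, ← h, norm_add_sq_real, inner_add_left, inner_smul_right, real_inner_smul_left,
    norm_smul, real_inner_self_eq_norm_sq, mul_pow, Real.norm_eq_abs, sq_abs]
  ring

theorem eq_pairTime {σ : ℝ} (hσ : σ ^ 2 = 1) {i j : Fin N} {Z : Config d N} {t : ℝ}
    (h : ‖(Z.1 + t • Z.2) i - (Z.1 + t • Z.2) j‖ = ε)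
    (hp : 0 < σ * inner ℝ ((Z.1 + t • Z.2) i - (Z.1 + t • Z.2) j) (Z.2 i - Z.2 j)) :
    t = pairTime ε σ i j Z := by
  set p := inner ℝ ((Z.1 + t • Z.2) i - (Z.1 + t • Z.2) j) (Z.2 i - Z.2 j) with hpdef
  have hw : Z.2 i - Z.2 j ≠ 0 := by
    intro hw
    rw [hpdef, hw, inner_zero_right, mul_zero] at hp
    exact lt_irrefl _ hp
  have hw' : ‖Z.2 i - Z.2 j‖ ^ 2 ≠ 0 := pow_ne_zero _ (norm_ne_zero_iff.2 hw)
  have hs : √(pairDisc ε i j Z) = σ * p := by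
    rw [pairDisc_eq_sq h, ← hpdef, ← one_mul (p ^ 2), ← hσ, ← mul_pow, Real.sqrt_sq hp.le]
  have e : (Z.1 + t • Z.2) i - (Z.1 + t • Z.2) j = (Z.1 i - Z.1 j) + t • (Z.2 i - Z.2 j) := by
    simp only [Pi.add_apply, Pi.smul_apply]
    module
  rw [pairTime, hs, ← mul_assoc, ← sq, hσ, one_mul, eq_div_iff hw', hpdef, e, inner_add_left,
    real_inner_smul_left, real_inner_self_eq_norm_sq]
  ring

theorem Collides.eq_pairTime {i j : Fin N} {Z : Config d N} {t : ℝ}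
    (h : Collides ε (Z.1 + t • Z.2) Z.2 i j) : t = pairTime ε (-1) i j Z :=
  HardSphere.eq_pairTime (by norm_num) h.1.2 (by linarith [h.inner_neg])

theorem Bounces.eq_wallTime {i : Fin N} {Z : Config d N} {t : ℝ}
    (h : Bounces ε (Z.1 + t • Z.2) Z.2 i) : t = wallTime ε i Z := by
  have h1 : inner ℝ ((Z.1 + t • Z.2) i) (e₁ d) = ε / 2 := h.1
  rw [wallTime, eq_div_iff h.2.ne, ← h1, Pi.add_apply, Pi.smul_apply, inner_add_left,
    real_inner_smul_left]
  ring

/-- An event takes place together with a contact of another particle or with the wall. -/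
def Degenerate (ε : ℝ) (x v : Fin N → Vec d) : Prop :=
  (∃ i j k l, k ≠ i ∧ k ≠ j ∧ Collides ε x v i j ∧ Touches ε x k l) ∨
  (∃ i j k, Collides ε x v i j ∧ TouchesWall ε x k) ∨
  (∃ i k, k ≠ i ∧ Bounces ε x v i ∧ TouchesWall ε x k) ∨
  (∃ i k l, k ≠ i ∧ Bounces ε x v i ∧ Touches ε x k l)

theorem SimultaneousEvents.degenerate {x v : Fin N → Vec d} {i : Fin N}
    (h : SimultaneousEvents ε x v i) : Degenerate ε x v := by
  rcases h with ⟨hb, j, hj⟩ | ⟨hw, j, hj⟩ | ⟨j, k, hjk, hj, hk⟩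
  · exact Or.inr (Or.inr (Or.inr ⟨i, j, i, hj.1.symm, hb, hj.symm⟩))
  · exact Or.inr (Or.inl ⟨i, j, i, hj, hw⟩)
  · exact Or.inl ⟨i, j, k, i, hk.1.symm, hjk.symm, hj, hk.symm⟩

/-- `Degenerate` also includes events of disjoint particles at the same time, harmless for the
dynamics. Excluding them leaves one collision or bounce per event time, so a single reverse map
undoes it. -/
theorem Collides.not_hasEvent {x v : Fin N → Vec d} (h : ¬ Degenerate ε x v) {i j m : Fin N}
    (hc : Collides ε x v i j) (hi : m ≠ i) (hj : m ≠ j) : ¬ HasEvent ε x v m := by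
  rintro (hb | ⟨l, hl⟩)
  · exact h (Or.inr (Or.inl ⟨i, j, m, hc, hb.1⟩))
  · exact h (Or.inl ⟨i, j, m, l, hi, hj, hc, hl.1⟩)

theorem Bounces.not_hasEvent {x v : Fin N → Vec d} (h : ¬ Degenerate ε x v) {i m : Fin N}
    (hb : Bounces ε x v i) (hi : m ≠ i) : ¬ HasEvent ε x v m := by
  rintro (hb' | ⟨l, hl⟩)
  · exact h (Or.inr (Or.inr (Or.inl ⟨i, m, hi, hb, hb'.1⟩)))
  · exact h (Or.inr (Or.inr (Or.inr ⟨i, m, l, hi, hb, hl.1⟩)))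

/-- The configurations whose free flight meets a degenerate event. -/
def degenerateSet (d N : ℕ) [NeZero d] (ε : ℝ) : Set (Config d N) :=
  {Z | ∃ t : ℝ, Degenerate ε (Z.1 + t • Z.2) Z.2}

theorem volume_degenerateSet : volume (degenerateSet d N ε) = 0 := by
  have hsub : degenerateSet d N ε ⊆
      (⋃ i, ⋃ j, ⋃ k, ⋃ l, {Z | (k ≠ i ∧ k ≠ j ∧ k ≠ l) ∧
        Touches ε (Z.1 + pairTime ε (-1) i j Z • Z.2) k l}) ∪
      ((⋃ i, ⋃ j, ⋃ k, {Z | TouchesWall ε (Z.1 + pairTime ε (-1) i j Z • Z.2) k}) ∪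
      ((⋃ i, ⋃ k, {Z | k ≠ i ∧ TouchesWall ε (Z.1 + wallTime ε i Z • Z.2) k}) ∪
      (⋃ i, ⋃ k, ⋃ l, {Z | (k ≠ i ∧ k ≠ l) ∧ Touches ε (Z.1 + wallTime ε i Z • Z.2) k l}))) := by
    rintro Z ⟨t, ⟨i, j, k, l, h1, h2, hc, ht⟩ | ⟨i, j, k, hc, ht⟩ | ⟨i, k, h1, hb, ht⟩ |
      ⟨i, k, l, h1, hb, ht⟩⟩
    · rw [hc.eq_pairTime] at ht
      refine Or.inl ?_
      simp only [mem_iUnion]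
      exact ⟨i, j, k, l, ⟨h1, h2, ht.1⟩, ht⟩
    · rw [hc.eq_pairTime] at ht
      refine Or.inr (Or.inl ?_)
      simp only [mem_iUnion]
      exact ⟨i, j, k, ht⟩
    · rw [hb.eq_wallTime] at ht
      refine Or.inr (Or.inr (Or.inl ?_))
      simp only [mem_iUnion]
      exact ⟨i, k, h1, ht⟩
    · rw [hb.eq_wallTime] at ht
      refine Or.inr (Or.inr (Or.inr ?_))
      simp only [mem_iUnion]
      exact ⟨i, k, l, ⟨h1, ht.1⟩, ht⟩
  refine measure_mono_null hsub (measure_union_null ?_ (measure_union_null ?_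
    (measure_union_null ?_ ?_))) <;> simp only [measure_iUnion_null_iff]
  · intro i j k l
    by_cases h : k ≠ i ∧ k ≠ j ∧ k ≠ l
    · refine measure_mono_null (fun Z hZ => hZ.2) (volume_touches_at_eq_zero
        (measurable_pairTime (-1) i j) (Pi.single k (e₁ d)) (pairTime_add_smul ?_) ?_ ?_)
      · rw [Pi.single_eq_of_ne h.1.symm, Pi.single_eq_of_ne h.2.1.symm]
      · rw [Pi.single_eq_same]
      · rw [Pi.single_eq_of_ne h.2.2.symm]
    · simp [h]
  · intro i j k
    -- Here `k` may be `i` or `j`, so all particles are translated together: the collision time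
    -- depends on relative positions only.
    exact volume_touchesWall_at_eq_zero (measurable_pairTime (-1) i j) (fun _ => e₁ d)
      (pairTime_add_smul rfl) rfl
  · intro i k
    by_cases h : k ≠ i
    · refine measure_mono_null (fun Z hZ => hZ.2) (volume_touchesWall_at_eq_zero
        (measurable_wallTime i) (Pi.single k (e₁ d)) (wallTime_add_smul ?_) ?_)
      · rw [Pi.single_eq_of_ne h.symm]
      · rw [Pi.single_eq_same]
    · simp [h]
  · intro i k l
    by_cases h : k ≠ i ∧ k ≠ l
    · refine measure_mono_null (fun Z hZ => hZ.2) (volume_touches_at_eq_zero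
        (measurable_wallTime i) (Pi.single k (e₁ d)) (wallTime_add_smul ?_) ?_ ?_)
      · rw [Pi.single_eq_of_ne h.1.symm]
      · rw [Pi.single_eq_same]
      · rw [Pi.single_eq_of_ne h.2.symm]
    · simp [h]

end NullSets

/-! ### Backward propagation through scatterings -/

section ReverseScattering

variable {d N : ℕ} [NeZero d] {ε : ℝ}

/-- The impulses of a collision, for the outgoing velocities `v`. -/
noncomputable def pairImpulse (ε : ℝ) (i j : Fin N) (x v : Fin N → Vec d) (m : Fin N) : Vec d :=
  (if m = i then (1 : ℝ) else if m = j then -1 else 0) •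
    (inner ℝ (x i - x j) (v i - v j) / ε ^ 2) • (x i - x j)

/-- The free flight before a collision, as a function of the free flight after it; a free flight is
given by its configuration at time `0`. -/
noncomputable def reversePair (ε : ℝ) (i j : Fin N) (Z : Config d N) : Config d N :=
  (Z.1 + pairTime ε 1 i j Z • pairImpulse ε i j (Z.1 + pairTime ε 1 i j Z • Z.2) Z.2,
    Z.2 - pairImpulse ε i j (Z.1 + pairTime ε 1 i j Z • Z.2) Z.2)

/-- The free flight before a bounce, as a function of the free flight after it. -/
noncomputable def reverseWall (ε : ℝ) (i : Fin N) (Z : Config d N) : Config d N :=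
  (fun m => Z.1 m +
      (if m = i then (1 : ℝ) else 0) • (2 * (ε / 2 - inner ℝ (Z.1 i) (e₁ d))) • e₁ d,
    fun m => Z.2 m - (if m = i then (1 : ℝ) else 0) • (2 * inner ℝ (Z.2 i) (e₁ d)) • e₁ d)

/-- The flights of the bouncing particle before and after are mirror images in the contact plane;
the bounce time does not enter and the map is affine. -/
theorem differentiable_reverseWall (i : Fin N) :
    Differentiable ℝ (reverseWall (d := d) ε i) := by
  unfold reverseWall
  refine Differentiable.prodMk (differentiable_pi.2 fun m => ?_) (differentiable_pi.2 fun m => ?_)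
  · have h : Differentiable ℝ fun Z : Config d N => inner ℝ (Z.1 i) (e₁ d) :=
      Differentiable.inner ℝ (by fun_prop) (by fun_prop)
    fun_prop
  · have h : Differentiable ℝ fun Z : Config d N => inner ℝ (Z.2 i) (e₁ d) :=
      Differentiable.inner ℝ (by fun_prop) (by fun_prop)
    fun_prop

/-- A positive discriminant keeps the square root smooth and also forces a nonzero relative
velocity, so the denominator does not vanish. -/
theorem differentiableAt_pairTime {σ : ℝ} {i j : Fin N} {Z : Config d N}
    (h : 0 < pairDisc ε i j Z) : DifferentiableAt ℝ (pairTime (d := d) ε σ i j) Z := by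
  have hw : ‖Z.2 i - Z.2 j‖ ^ 2 ≠ 0 := by
    intro hw
    rw [pairDisc, hw, norm_eq_zero.1 (pow_eq_zero_iff two_ne_zero |>.1 hw), inner_zero_right] at h
    simp at h
  have h1 : Differentiable ℝ (fun Z : Config d N => ‖Z.2 i - Z.2 j‖ ^ 2) :=
    Differentiable.norm_sq ℝ (by fun_prop)
  have h2 : Differentiable ℝ (fun Z : Config d N => ‖Z.1 i - Z.1 j‖ ^ 2) :=
    Differentiable.norm_sq ℝ (by fun_prop)
  have h3 : Differentiable ℝ
      (fun Z : Config d N => inner ℝ (Z.1 i - Z.1 j) (Z.2 i - Z.2 j)) :=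
    Differentiable.inner ℝ (by fun_prop) (by fun_prop)
  have h4 : Differentiable ℝ (pairDisc (d := d) ε i j) :=
    (h3.pow 2).sub (h1.mul (h2.sub_const _))
  have h5 := h4.differentiableAt.sqrt h.ne' |>.const_mul σ
  unfold pairTime
  simp only [div_eq_mul_inv]
  exact ((h3 Z).neg.add h5).mul ((h1 Z).inv hw)

theorem differentiableOn_reversePair (i j : Fin N) :
    DifferentiableOn ℝ (reversePair (d := d) ε i j) {Z | 0 < pairDisc ε i j Z} := by
  intro Z hZ
  refine DifferentiableAt.differentiableWithinAt ?_
  have ht := differentiableAt_pairTime (σ := 1) hZ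
  have hx : DifferentiableAt ℝ (fun Z : Config d N => Z.1 + pairTime ε 1 i j Z • Z.2) Z := by
    fun_prop
  have hK : DifferentiableAt ℝ (fun Z : Config d N =>
      pairImpulse ε i j (Z.1 + pairTime ε 1 i j Z • Z.2) Z.2) Z := by
    refine differentiableAt_pi.2 fun m => ?_
    have hxi : ∀ k, DifferentiableAt ℝ
        (fun Z : Config d N => (Z.1 + pairTime ε 1 i j Z • Z.2) k) Z := differentiableAt_pi.1 hx
    have hy := (hxi i).sub (hxi j)
    have hw : DifferentiableAt ℝ (fun Z : Config d N => Z.2 i - Z.2 j) Z := by fun_prop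
    have hyw := hy.inner ℝ hw
    simp only [Pi.sub_apply] at hyw
    unfold pairImpulse
    fun_prop
  exact (differentiableAt_fst.add (ht.smul hK)).prodMk (differentiableAt_snd.sub hK)

/-- The free flights that lead to a degenerate event after at most `n` reverse scatterings. -/
def badSet (d N : ℕ) [NeZero d] (ε : ℝ) : ℕ → Set (Config d N)
  | 0 => degenerateSet d N ε
  | n + 1 => (⋃ i, ⋃ j, reversePair ε i j '' (badSet d N ε n ∩ {Z | 0 < pairDisc ε i j Z})) ∪
      ⋃ i, reverseWall ε i '' badSet d N ε n

theorem volume_badSet (n : ℕ) : volume (badSet d N ε n) = 0 := by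
  induction n with
  | zero => exact volume_degenerateSet
  | succ n ih =>
    refine measure_union_null ?_ ?_ <;> simp only [measure_iUnion_null_iff]
    · intro i j
      exact addHaar_image_eq_zero_of_differentiableOn_of_addHaar_eq_zero volume
        ((differentiableOn_reversePair i j).mono inter_subset_right)
        (measure_mono_null inter_subset_left ih)
    · intro i
      exact addHaar_image_eq_zero_of_differentiableOn_of_addHaar_eq_zero volume
        (differentiable_reverseWall i).differentiableOn ih

/-- After the collision the particles separate, so its time is the leaving root of the outgoing
flight, and the outgoing velocities determine the impulse because the radial velocity merely changes
sign. -/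
theorem reversePair_eq (hε : 0 < ε) {x v v' : Fin N → Vec d} (hv : IsOutgoing ε x v v')
    (hd : ¬ Degenerate ε x v) {i j : Fin N} (h : Collides ε x v i j) (s : ℝ) :
    0 < pairDisc ε i j (x - s • v', v') ∧
      reversePair ε i j (x - s • v', v') = (x - s • v, v) := by
  have hx : x - s • v' + s • v' = x := sub_add_cancel x (s • v')
  have hpos : 0 < inner ℝ (x i - x j) (v' i - v' j) := by
    rw [h.inner_out hε hv]
    linarith [h.inner_neg]
  have hnorm : ‖(x - s • v' + s • v') i - (x - s • v' + s • v') j‖ = ε := by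
    rw [hx]
    exact h.1.2
  have ht : pairTime ε 1 i j (x - s • v', v') = s := by
    refine (eq_pairTime (Z := (x - s • v', v')) (σ := 1) (by norm_num) hnorm ?_).symm
    simp only [hx]
    linarith
  have hK : pairImpulse ε i j x v' = v' - v := by
    funext m
    rw [Pi.sub_apply, pairImpulse, h.inner_out hε hv]
    by_cases hmi : m = i
    · subst hmi
      rw [if_pos rfl, h.out_eq hv]
      module
    · by_cases hmj : m = j
      · subst hmj
        rw [if_neg hmi, if_pos rfl, h.symm.out_eq hv, ← neg_sub (x i) (x m),
          ← neg_sub (v i) (v m), inner_neg_neg]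
        module
      · rw [if_neg hmi, if_neg hmj, (hv m).2.2 (h.not_hasEvent hd hmi hmj), sub_self, zero_smul]
  refine ⟨?_, ?_⟩
  · have hdisc := pairDisc_eq_sq (Z := (x - s • v', v')) (t := s) hnorm
    rw [hdisc]
    simp only [hx]
    exact pow_pos hpos 2
  · rw [reversePair, ht]
    simp only [hx, hK]
    ext1
    · simp only
      module
    · simp

theorem reverseWall_eq {x v v' : Fin N → Vec d} (hv : IsOutgoing ε x v v')
    (hd : ¬ Degenerate ε x v) {i : Fin N} (h : Bounces ε x v i) (s : ℝ) :
    reverseWall ε i (x - s • v', v') = (x - s • v, v) := by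
  have hi : inner ℝ (x i) (e₁ d) = ε / 2 := h.1
  have ho := h.inner_out hv
  have hK : ∀ m, v m = v' m - (if m = i then (1 : ℝ) else 0) •
      (2 * inner ℝ (v' i) (e₁ d)) • e₁ d := by
    intro m
    by_cases hmi : m = i
    · subst hmi
      rw [if_pos rfl, ho, (hv m).1 h]
      module
    · rw [if_neg hmi, (hv m).2.2 (h.not_hasEvent hd hmi)]
      simp
  ext1
  · funext m
    simp only [reverseWall, Pi.sub_apply, Pi.smul_apply, inner_sub_left, real_inner_smul_left, hi]
    rw [hK m]
    module
  · funext m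
    exact (hK m).symm

variable {Z : Config d N} {T : ℝ} {x vin vout : ℝ → Fin N → Vec d}

/-- The code `x t - t • vin t` is unchanged by free flight. Going back from `t` to `s` only undoes
the event at `s`, unless that event is degenerate and the flight is already in `badSet d N ε 0`. -/
theorem IsMotion.mem_iUnion_badSet (hε : 0 < ε) (h : IsMotion ε Z T x vin vout)
    (hT : (x T - T • vin T, vin T) ∈ ⋃ n, badSet d N ε n) : Z ∈ ⋃ n, badSet d N ε n := by
  have key : (x 0 - (0 : ℝ) • vin 0, vin 0) ∈ ⋃ n, badSet d N ε n := by
    rcases h.nonneg.eq_or_lt with rfl | h0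
    · exact hT
    refine h.rel (P := fun s t => (x t - t • vin t, vin t) ∈ ⋃ n, badSet d N ε n →
      (x s - s • vin s, vin s) ∈ ⋃ n, badSet d N ε n) le_rfl (fun s t hs hst ht hx hv hmem => ?_)
      (fun s u t _ _ _ _ h1 h2 h3 => h1 (h2 h3)) le_rfl h0 le_rfl hT
    have hout := h.outgoing s ⟨hs, hst.trans_le ht⟩
    have e : x t - t • vin t = x s - s • vout s := by
      rw [hx, hv]
      module
    rw [e, hv] at hmem
    by_cases hd : Degenerate ε (x s) (vin s)
    · refine mem_iUnion.2 ⟨0, s, ?_⟩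
      simpa using hd
    by_cases hev : ∃ i, HasEvent ε (x s) (vin s) i
    · obtain ⟨n, hn⟩ := mem_iUnion.1 hmem
      refine mem_iUnion.2 ⟨n + 1, ?_⟩
      obtain ⟨i, hb | ⟨j, hc⟩⟩ := hev
      · refine Or.inr (mem_iUnion.2 ⟨i, _, hn, reverseWall_eq hout hd hb s⟩)
      · obtain ⟨h1, h2⟩ := reversePair_eq hε hout hd hc s
        exact Or.inl (mem_iUnion₂.2 ⟨i, j, _, ⟨hn, h1⟩, h2⟩)
    · push Not at hev
      rwa [outgoing_eq_of_not_hasEvent hout hev] at hmem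
  rwa [zero_smul, sub_zero, h.init_pos, h.init_vel] at key

theorem Pathological.mem_iUnion_badSet (hε : 0 < ε) (h : Pathological ε Z) :
    Z ∈ ⋃ n, badSet d N ε n := by
  obtain ⟨T, x, vin, vout, hm, i, hi⟩ := h
  refine hm.mem_iUnion_badSet hε (mem_iUnion.2 ⟨0, T, ?_⟩)
  simpa using hi.degenerate

theorem volume_pathological (hε : 0 < ε) :
    volume {Z : Config d N | Pathological ε Z} = 0 :=
  measure_mono_null (fun _ hZ => Pathological.mem_iUnion_badSet hε hZ)
    (measure_iUnion_null volume_badSet)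

end ReverseScattering
end HardSphere

theorem mainTheorem9 (d N : ℕ) [NeZero d] (hd : 2 ≤ d) (hN : 2 ≤ N)
    (ε : ℝ) (hε : 0 < ε) (hε1 : ε ≤ 1) :
    volume {Z : HardSphere.Config d N |
      Z ∈ HardSphere.phaseSpace d N ε ∧ HardSphere.Pathological ε Z} = 0 ∧
    (∀ᵐ Z : HardSphere.Config d N, Z ∈ HardSphere.phaseSpace d N ε →
      ∀ t : ℝ, ¬ AccPt t (Filter.principal (HardSphere.eventTimes ε Z))) ∧
    (∀ᵐ Z : HardSphere.Config d N, Z ∈ HardSphere.phaseSpace d N ε →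
      HardSphere.GloballyDefined ε Z) := by
  have : Nonempty (Fin N) := ⟨⟨0, by omega⟩⟩
  have h0 := HardSphere.volume_pathological (d := d) (N := N) hε
  have hae : ∀ᵐ Z : HardSphere.Config d N, ¬ HardSphere.Pathological ε Z := by
    simpa [ae_iff] using h0
  refine ⟨measure_mono_null (fun Z hZ => hZ.2) h0, ?_, ?_⟩
  · filter_upwards [hae] with Z hp hZ t
    exact HardSphere.not_accPt_eventTimes
      (HardSphere.globallyDefined_of_not_pathological hε hZ hp) t
  · filter_upwards [hae] with Z hp hZ
    exact HardSphere.globallyDefined_of_not_pathological hε hZ hp
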